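/- A \emph{Reedy category} is a small category $R$ with two subcategories $R^+$ and $R^-$ containing all the objects, and an ordinal-valued degree function $d$ on its objects, such that every morphism $f$ has a unique factorization $f=f^+f^-$ with $f^-\in R^-$ and $f^+\in R^+$, and such that non-identity morphisms of $R^+$ strictly raise the degree while those of $R^-$ strictly lower it. For an ordinal $\mu$, let $R_{<\mu}$ be the full subcategory on the objects of degree strictly less than $\mu$; it is again a Reedy category. Let $M$ be a model category, i.e. a complete and cocomplete category with a model structure. For a diagram $X\colon R\to M$ and an object $r$ of $R$, the latching and matching objects are the coend and the end $$L_rX=\int^{s\in R_{<d(r)}}\ \coprod_{\mathrm{Hom}_R(s,r)}X_s,\qquad M_rX=\int_{s\in R_{<d(r)}}\ \prod_{\mathrm{Hom}_R(r,s)}X_s .$$ The \emph{Reedy triple} on the functor category $[R,M]$ consists of the following three classes of maps $f\colon X\to Y$: the \emph{Reedy cofibrations}, for which $L_rY\sqcup_{L_rX}X_r\to Y_r$ is a cofibration of $M$ for every object $r$ of $R$; the \emph{Reedy weak equivalences}, for which $f_r\colon X_r\to Y_r$ is a weak equivalence of $M$ for every $r$; and the \emph{Reedy fibrations}, for which $X_r\to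 M_rX\times_{M_rY}Y_r$ is a fibration of $M$ for every $r$. \textbf{Proposition.} Let $R$ be a Reedy category, $M$ a model category and $\mu$ an ordinal. If the Reedy triple of the Reedy category $R_{<\mu}$ makes $[R_{<\mu},M]$ a model category, then the Reedy triple of $R_{<\mu+1}$ makes $[R_{<\mu+1},M]$ a model category. -/

import Mathlib

open CategoryTheory CategoryTheory.Limits HomotopicalAlgebra Opposite

universe t w v u

namespace ReedyDiagrams

section ReedyCategory

/-!
A Reedy category is a small category `R` with two classes of morphisms `Rm` (lowering the degree)
and `Rp` (raising the degree), both closed under composition and containing the identities, and a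
term of Mathlib's `HomotopicalAlgebra.ReedyStructure Rm Rp Ordinal`, which consists of the
ordinal-valued degree function and of the axioms.
-/

variable {R : Type w} [SmallCategory R] {Rm Rp : MorphismProperty R}
  [Rm.IsMultiplicative] [Rp.IsMultiplicative] (S : ReedyStructure Rm Rp Ordinal.{t})

/-- The objects of degree strictly less than `κ`. -/
def degLT (κ : Ordinal.{t}) : ObjectProperty R := fun r ↦ S.deg r < κ

/-- The full subcategory `R_{<κ}` of the objects of degree strictly less than `κ`. -/
abbrev Below (κ : Ordinal.{t}) : Type w := (degLT S κ).FullSubcategory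

/-- The inclusion functor `R_{<κ} ⥤ R`. -/
abbrev incl (κ : Ordinal.{t}) : Below S κ ⥤ R := (degLT S κ).ι

lemma identities_of_hom (κ : Ordinal.{t}) {X Y : Below S κ} (f : X ⟶ Y)
    (h : MorphismProperty.identities R f.hom) :
    MorphismProperty.identities (Below S κ) f := by
  rcases X with ⟨X, hX⟩
  rcases Y with ⟨Y, hY⟩
  rcases f with ⟨f⟩
  dsimp at f h
  cases h
  exact MorphismProperty.id_mem _ (⟨X, hX⟩ : Below S κ)

/-- The Reedy structure which `R_{<κ}` inherits from `R`. -/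
def below (κ : Ordinal.{t}) :
    ReedyStructure (Rm.inverseImage (incl S κ)) (Rp.inverseImage (incl S κ)) Ordinal.{t} where
  deg r := S.deg r.obj
  lt₁ {X Y} f hf hf' := S.lt₁ f.hom hf (fun h ↦ hf' (identities_of_hom S κ f h))
  lt₂ {X Y} f hf hf' := S.lt₂ f.hom hf (fun h ↦ hf' (identities_of_hom S κ f h))
  nonempty_unique {X Y} f := by
    obtain ⟨hu⟩ := S.nonempty_unique f.hom
    let fac : (Rm.inverseImage (incl S κ)).MapFactorizationData
        (Rp.inverseImage (incl S κ)) f :=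
      { Z := ⟨hu.default.Z, lt_of_le_of_lt (S.le₁ _ hu.default.hi) X.property⟩
        i := ObjectProperty.homMk hu.default.i
        p := ObjectProperty.homMk hu.default.p
        fac := ObjectProperty.hom_ext _ hu.default.fac
        hi := hu.default.hi
        hp := hu.default.hp }
    refine ⟨⟨⟨fac⟩, fun g ↦ ?_⟩⟩
    let g' : Rm.MapFactorizationData Rp f.hom :=
      { Z := g.Z.obj
        i := g.i.hom
        p := g.p.hom
        fac := by rw [← ObjectProperty.FullSubcategory.comp_hom, g.fac]
        hi := g.hi
        hp := g.hp }
    have hg : g' = hu.default := hu.uniq g'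
    have key : ∀ (h h' : Rm.MapFactorizationData Rp f.hom) (hZ : degLT S κ h.Z)
        (hZ' : degLT S κ h'.Z), h = h' →
        (⟨⟨h.Z, hZ⟩, ObjectProperty.homMk h.i, ObjectProperty.homMk h.p,
          ObjectProperty.hom_ext _ h.fac, h.hi, h.hp⟩ :
          (Rm.inverseImage (incl S κ)).MapFactorizationData
            (Rp.inverseImage (incl S κ)) f) =
        ⟨⟨h'.Z, hZ'⟩, ObjectProperty.homMk h'.i, ObjectProperty.homMk h'.p,
          ObjectProperty.hom_ext _ h'.fac, h'.hi, h'.hp⟩ := by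
      rintro h _ hZ hZ' rfl
      rfl
    exact key g' hu.default g.Z.property _ hg

end ReedyCategory

section Triple

variable {R : Type w} [SmallCategory R] {Rm Rp : MorphismProperty R}
  [Rm.IsMultiplicative] [Rp.IsMultiplicative] (S : ReedyStructure Rm Rp Ordinal.{t})
  {M : Type u} [Category.{v} M]

section Latching

variable [HasColimitsOfSize.{w, w} M]

/-- For a diagram `X` on `R` and an object `r` of `R`, the functor
`(s', s) ↦ Hom(s', r) ⊙ X_s = ∐_{Hom(s', r)} X_s` on `(R_{<deg r})ᵒᵖ × R_{<deg r}`. -/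
noncomputable abbrev latchingBifunctor (X : R ⥤ M) (r : R) :
    (Below S (S.deg r))ᵒᵖ ⥤ Below S (S.deg r) ⥤ M :=
  ((incl S (S.deg r)).op ⋙ yoneda.obj r) ⋙ (incl S (S.deg r) ⋙ X ⋙ sigmaConst.{w}).flip

/-- The latching object `L_r X`: the coend of `Hom(s, r) ⊙ X_s` over `s ∈ R_{<deg r}`. -/
noncomputable def latchingObj (X : R ⥤ M) (r : R) : M :=
  coend (latchingBifunctor S X r)

/-- The map `L_r X ⟶ L_r Y` induced by `f : X ⟶ Y`. -/
noncomputable def latchingMap {X Y : R ⥤ M} (f : X ⟶ Y) (r : R) :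
    latchingObj S X r ⟶ latchingObj S Y r :=
  coend.map (F := latchingBifunctor S X r) (F' := latchingBifunctor S Y r)
    (Functor.whiskerLeft ((incl S (S.deg r)).op ⋙ yoneda.obj r)
      ((flipFunctor _ _ _).map
        (Functor.whiskerLeft (incl S (S.deg r)) (Functor.whiskerRight f sigmaConst.{w}))))

/-- The canonical map `L_r X ⟶ X_r`, with component `X_g` at `g : s ⟶ r`. -/
noncomputable def fromLatching (X : R ⥤ M) (r : R) : latchingObj S X r ⟶ X.obj r :=
  coend.desc (F := latchingBifunctor S X r)
    (fun s ↦ Sigma.desc fun g : s.obj ⟶ r ↦ X.map g) (by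
      intros
      dsimp [latchingBifunctor]
      apply Sigma.hom_ext
      intro
      simp)

lemma latchingMap_comp_fromLatching {X Y : R ⥤ M} (f : X ⟶ Y) (r : R) :
    latchingMap S f r ≫ fromLatching S Y r = fromLatching S X r ≫ f.app r := by
  apply coend.hom_ext
  intro s
  refine (coend.ι_map_assoc _ _ _).trans ?_
  refine Eq.trans ?_ (coend.ι_desc_assoc _ _ _ _).symm
  refine (congrArg _ (coend.ι_desc _ _ _)).trans ?_
  dsimp
  apply Sigma.hom_ext
  intro
  simp

/-- The relative latching map `L_r Y ⊔_{L_r X} X_r ⟶ Y_r` of `f : X ⟶ Y`. -/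
noncomputable def relLatchingMap [HasPushouts M] {X Y : R ⥤ M} (f : X ⟶ Y) (r : R) :
    pushout (latchingMap S f r) (fromLatching S X r) ⟶ Y.obj r :=
  pushout.desc (fromLatching S Y r) (f.app r) (latchingMap_comp_fromLatching S f r)

end Latching

section Matching

variable [HasLimitsOfSize.{w, w} M]

/-- For a diagram `X` on `R` and an object `r` of `R`, the functor
`(s', s) ↦ Hom(r, s') ⋔ X_s = ∏_{Hom(r, s')} X_s` on `(R_{<deg r})ᵒᵖ × R_{<deg r}`. -/
noncomputable abbrev matchingBifunctor (X : R ⥤ M) (r : R) :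
    (Below S (S.deg r))ᵒᵖ ⥤ Below S (S.deg r) ⥤ M :=
  (incl S (S.deg r) ⋙ coyoneda.obj (op r)).op ⋙ (incl S (S.deg r) ⋙ X ⋙ piConst.{w}).flip

/-- The matching object `M_r X`: the end of `Hom(r, s) ⋔ X_s` over `s ∈ R_{<deg r}`. -/
noncomputable def matchingObj (X : R ⥤ M) (r : R) : M :=
  end_ (matchingBifunctor S X r)

/-- The map `M_r X ⟶ M_r Y` induced by `f : X ⟶ Y`. -/
noncomputable def matchingMap {X Y : R ⥤ M} (f : X ⟶ Y) (r : R) :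
    matchingObj S X r ⟶ matchingObj S Y r :=
  end_.map (F := matchingBifunctor S X r) (F' := matchingBifunctor S Y r)
    (Functor.whiskerLeft (incl S (S.deg r) ⋙ coyoneda.obj (op r)).op
      ((flipFunctor _ _ _).map
        (Functor.whiskerLeft (incl S (S.deg r)) (Functor.whiskerRight f piConst.{w}))))

/-- The canonical map `X_r ⟶ M_r X`, with component `X_g` at `g : r ⟶ s`. -/
noncomputable def toMatching (X : R ⥤ M) (r : R) : X.obj r ⟶ matchingObj S X r :=
  end_.lift (F := matchingBifunctor S X r)
    (fun s ↦ Pi.lift fun g : r ⟶ s.obj ↦ X.map g) (by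
      intros
      dsimp [matchingBifunctor]
      apply Pi.hom_ext
      intro
      simp)

lemma toMatching_comp_matchingMap {X Y : R ⥤ M} (f : X ⟶ Y) (r : R) :
    toMatching S X r ≫ matchingMap S f r = f.app r ≫ toMatching S Y r := by
  apply end_.hom_ext
  intro s
  refine (Category.assoc _ _ _).trans ?_
  refine (congrArg _ (end_.map_π _ _)).trans ?_
  refine (end_.lift_π_assoc _ _ _ _).trans ?_
  refine Eq.trans ?_ (Category.assoc _ _ _).symm
  refine Eq.trans ?_ (congrArg _ (end_.lift_π _ _ _)).symm
  dsimp
  apply Pi.hom_ext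
  intro
  simp

/-- The relative matching map `X_r ⟶ M_r X ×_{M_r Y} Y_r` of `f : X ⟶ Y`. -/
noncomputable def relMatchingMap [HasPullbacks M] {X Y : R ⥤ M} (f : X ⟶ Y) (r : R) :
    X.obj r ⟶ pullback (matchingMap S f r) (toMatching S Y r) :=
  pullback.lift (toMatching S X r) (f.app r) (toMatching_comp_matchingMap S f r)

end Matching

variable (M) [ModelCategory M]

/-- Reedy cofibrations: every relative latching map is a cofibration. -/
def reedyCofibrations [HasColimitsOfSize.{w, w} M] : MorphismProperty (R ⥤ M) :=
  fun _ _ f ↦ ∀ r : R, cofibrations M (relLatchingMap S f r)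

/-- Reedy weak equivalences: the pointwise weak equivalences. -/
def reedyWeakEquivalences (R : Type w) [SmallCategory R] : MorphismProperty (R ⥤ M) :=
  fun _ _ f ↦ ∀ r : R, weakEquivalences M (f.app r)

/-- Reedy fibrations: every relative matching map is a fibration. -/
def reedyFibrations [HasLimitsOfSize.{w, w} M] : MorphismProperty (R ⥤ M) :=
  fun _ _ f ↦ ∀ r : R, fibrations M (relMatchingMap S f r)

/-- The three classes of maps `(C, W, F)` make `E` a model category. -/
def MakesModelCategory {E : Type*} [Category* E] (C W F : MorphismProperty E) : Prop :=
  ∃ m : ModelCategory E,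
    m.categoryWithCofibrations.cofibrations = C ∧
    m.categoryWithWeakEquivalences.weakEquivalences = W ∧
    m.categoryWithFibrations.fibrations = F

/-- The Reedy triple makes the category of diagrams `R ⥤ M` a model category. -/
def ReedyTripleIsModel [HasLimitsOfSize.{w, w} M] [HasColimitsOfSize.{w, w} M] : Prop :=
  MakesModelCategory (reedyCofibrations S M) (reedyWeakEquivalences M R) (reedyFibrations S M)

end Triple

end ReedyDiagrams

/-!
The relative latching and matching maps enter the model category axioms only through lifting
properties, and these can be expressed without any (co)limit: a map out of a latching object is a
compatible family of maps `X_s ⟶ E` (`LatchFamily`), a map into a matching object is a compatible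
family of maps `A ⟶ X_s` (`MatchFamily`), and the relative latching map of `f` has the left lifting
property against `p` if and only if `LatchLift` holds. This makes the conditions independent of how
the latching object is presented (`latchLift_whiskerLeft_iff`), so that `R_{<μ+1}` may be replaced
with an equivalent category `Stage S μ`, whose objects are those of `R_{<μ}` and those of degree
exactly `μ`.

A morphism between objects of degree `μ` is an identity or factors through `R_{<μ}`, never both, and
any two factorizations of it through `R_{<μ}` are connected by a zigzag (`isReedyLike_stage`); this
follows from the uniqueness of Reedy factorizations (`exists_zigzag`). Hence a diagram on
`Stage S μ` is a diagram `Z` on `R_{<μ}` with a factorization `L_x Z ⟶ Z_x ⟶ M_x Z` of the canonical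
map for every `x` of degree `μ` (`Glue.ExtensionData.functor`). It follows that weak factorization
systems on `[R_{<μ}, M]` and on `M` glue to one on the diagrams of shape `Stage S μ`: a map is in
the left class if its restriction to `R_{<μ}` and its relative latching maps at the objects of
degree `μ` are (`Glue.isWeakFactorizationSystem_glued`). This applies both to (cofibrations, trivial
fibrations) and to (trivial cofibrations, fibrations).

It remains to see that the glued trivial fibrations are the fibrations which are weak equivalences,
and dually. Since `f_x` is the relative matching map followed by a base change of `M_x f`, this
holds by the two-out-of-three property as soon as `M_x` sends the trivial fibrations of
`[R_{<μ}, M]` to trivial fibrations of `M` (`stageFibrations_inf_weakEquivalences`). Now `M_x` is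
right adjoint to `A ↦ Hom(x, -) ⊙ A`, so it is enough that this functor preserves cofibrations
(`matchMap_mem_of_wfs`), and it does: the latching maps of `Hom(x, -)` are injective, again by the
connectedness of factorizations, so the relative latching maps of `Hom(x, -) ⊙ A ⟶ Hom(x, -) ⊙ B`
are coproducts of copies of `A ⟶ B` and of identities (`latchLift_copowerMap`).
-/

namespace ReedyDiagrams

/-! ### Compatible families and relative lifting conditions -/

section Families

variable {P : Type*} [Category* P] {Q : Type*} [Category* Q] {M : Type u} [Category.{v} M]

/-- A family of maps `Z_s ⟶ E`, indexed by the morphisms `g : ι s ⟶ r` and natural in `(s, g)`.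
The latching object is the universal target of such a family. -/
structure LatchFamily (ι : P ⥤ Q) (Z : P ⥤ M) (r : Q) (E : M) where
  /-- the component at `g : ι s ⟶ r` -/
  app (s : P) (g : ι.obj s ⟶ r) : Z.obj s ⟶ E
  naturality {s t : P} (k : s ⟶ t) (g : ι.obj t ⟶ r) :
    Z.map k ≫ app t g = app s (ι.map k ≫ g)

/-- A family of maps `A ⟶ Z_s`, indexed by the morphisms `g : r ⟶ ι s` and natural in `(s, g)`.
The matching object is the universal source of such a family. -/
structure MatchFamily (ι : P ⥤ Q) (Z : P ⥤ M) (r : Q) (A : M) where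
  /-- the component at `g : r ⟶ ι s` -/
  app (s : P) (g : r ⟶ ι.obj s) : A ⟶ Z.obj s
  naturality {s t : P} (k : s ⟶ t) (g : r ⟶ ι.obj s) :
    app s g ≫ Z.map k = app t (g ≫ ι.map k)

/-- Every family factors uniquely through `φ`. -/
def LatchFamily.IsUniversal {ι : P ⥤ Q} {Z : P ⥤ M} {r : Q} {L : M}
    (φ : LatchFamily ι Z r L) : Prop :=
  ∀ ⦃E : M⦄ (ψ : LatchFamily ι Z r E), ∃! d : L ⟶ E, ∀ s g, φ.app s g ≫ d = ψ.app s g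

/-- Every family factors uniquely through `φ`. -/
def MatchFamily.IsUniversal {ι : P ⥤ Q} {Z : P ⥤ M} {r : Q} {L : M}
    (φ : MatchFamily ι Z r L) : Prop :=
  ∀ ⦃A : M⦄ (ψ : MatchFamily ι Z r A), ∃! d : A ⟶ L, ∀ s g, d ≫ φ.app s g = ψ.app s g

lemma LatchFamily.IsUniversal.hom_ext {ι : P ⥤ Q} {Z : P ⥤ M} {r : Q} {L : M}
    {φ : LatchFamily ι Z r L} (hφ : φ.IsUniversal) {E : M} {d d' : L ⟶ E}
    (h : ∀ s g, φ.app s g ≫ d = φ.app s g ≫ d') : d = d' :=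
  (hφ ⟨fun s g ↦ φ.app s g ≫ d', fun k g ↦ by rw [← φ.naturality k g, Category.assoc]⟩).unique
    h fun _ _ ↦ rfl

lemma MatchFamily.IsUniversal.hom_ext {ι : P ⥤ Q} {Z : P ⥤ M} {r : Q} {L : M}
    {φ : MatchFamily ι Z r L} (hφ : φ.IsUniversal) {A : M} {d d' : A ⟶ L}
    (h : ∀ s g, d ≫ φ.app s g = d' ≫ φ.app s g) : d = d' :=
  (hφ ⟨fun s g ↦ d' ≫ φ.app s g, fun k g ↦ by rw [← φ.naturality k g, Category.assoc]⟩).unique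
    h fun _ _ ↦ rfl

/-- The left lifting property against `p` of the relative latching map of `f` at `r`, with all maps
out of latching objects and pushouts spelled out as families. -/
def LatchLift (ι : P ⥤ Q) {X Y : Q ⥤ M} (f : X ⟶ Y) (r : Q) {E B : M} (p : E ⟶ B) : Prop :=
  ∀ (φ : LatchFamily ι (ι ⋙ Y) r E) (α : X.obj r ⟶ E) (β : Y.obj r ⟶ B),
    (∀ s g, f.app (ι.obj s) ≫ φ.app s g = X.map g ≫ α) → α ≫ p = f.app r ≫ β →
    (∀ s g, φ.app s g ≫ p = Y.map g ≫ β) →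
    ∃ l : Y.obj r ⟶ E, (∀ s g, Y.map g ≫ l = φ.app s g) ∧ f.app r ≫ l = α ∧ l ≫ p = β

/-- The right lifting property against `i` of the relative matching map of `f` at `r`, with all maps
into matching objects and pullbacks spelled out as families. -/
def MatchLift (ι : P ⥤ Q) {X Y : Q ⥤ M} (f : X ⟶ Y) (r : Q) {A B : M} (i : A ⟶ B) : Prop :=
  ∀ (φ : MatchFamily ι (ι ⋙ X) r B) (α : B ⟶ Y.obj r) (β : A ⟶ X.obj r),
    (∀ s g, φ.app s g ≫ f.app (ι.obj s) = α ≫ Y.map g) → β ≫ f.app r = i ≫ α →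
    (∀ s g, i ≫ φ.app s g = β ≫ X.map g) →
    ∃ l : B ⟶ X.obj r, (∀ s g, l ≫ X.map g = φ.app s g) ∧ l ≫ f.app r = α ∧ i ≫ l = β

section Pushout

variable [HasPushouts M] {ι : P ⥤ Q} {X Y : Q ⥤ M} (f : X ⟶ Y) (r : Q) {LX LY : M}
  {iX : LatchFamily ι (ι ⋙ X) r LX} (hX : iX.IsUniversal)
  {iY : LatchFamily ι (ι ⋙ Y) r LY} (hY : iY.IsUniversal)
  {m : LX ⟶ LY} (hm : ∀ s g, iX.app s g ≫ m = f.app (ι.obj s) ≫ iY.app s g)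
  {a : LX ⟶ X.obj r} (ha : ∀ s g, iX.app s g ≫ a = X.map g)
  {b : LY ⟶ Y.obj r} (hb : ∀ s g, iY.app s g ≫ b = Y.map g)
  (w : m ≫ b = a ≫ f.app r)

include hX hY hm ha hb in
lemma hasLiftingProperty_pushoutDesc_iff {E B : M} (p : E ⟶ B) :
    HasLiftingProperty (pushout.desc b (f.app r) w) p ↔ LatchLift ι f r p := by
  constructor
  · intro h φ α β h₁ h₂ h₃
    obtain ⟨d, hd, -⟩ := hY φ
    have hd' : m ≫ d = a ≫ α := hX.hom_ext fun s g ↦ by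
      rw [reassoc_of% hm, hd, h₁, reassoc_of% ha]
    have sq : CommSq (pushout.desc d α hd') (pushout.desc b (f.app r) w) p β := by
      refine ⟨pushout.hom_ext ?_ ?_⟩
      · simp only [pushout.inl_desc_assoc]
        exact hY.hom_ext fun s g ↦ by rw [reassoc_of% hd, h₃, reassoc_of% hb]
      · rw [pushout.inr_desc_assoc, pushout.inr_desc_assoc, h₂]
    refine ⟨sq.lift, fun s g ↦ ?_, ?_, sq.fac_right⟩
    · rw [← hb, Category.assoc, ← hd]
      congr 1
      simpa only [pushout.inl_desc, pushout.inl_desc_assoc] using (pushout.inl m a) ≫= sq.fac_left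
    · simpa only [pushout.inr_desc, pushout.inr_desc_assoc] using
        (pushout.inr m a) ≫= sq.fac_left
  · intro h
    refine ⟨fun {α' β} sq ↦ ?_⟩
    have sqw := sq.w
    obtain ⟨l, h₁, h₂, h₃⟩ := h
      ⟨fun s g ↦ iY.app s g ≫ pushout.inl m a ≫ α', fun k g ↦ by
        rw [← iY.naturality k g, Category.assoc]⟩ (pushout.inr m a ≫ α') β
      (fun s g ↦ by
        rw [← reassoc_of% hm, pushout.condition_assoc, reassoc_of% ha])
      (by simpa only [pushout.inr_desc_assoc, Category.assoc] using (pushout.inr m a) ≫= sqw)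
      (fun s g ↦ by
        have := (iY.app s g ≫ pushout.inl m a) ≫= sqw
        simp only [Category.assoc, pushout.inl_desc_assoc, reassoc_of% hb] at this ⊢
        exact this)
    refine ⟨⟨⟨l, ?_, h₃⟩⟩⟩
    refine pushout.hom_ext ?_ ?_
    · rw [pushout.inl_desc_assoc]
      exact hY.hom_ext fun s g ↦ by rw [reassoc_of% hb, h₁]
    · rw [pushout.inr_desc_assoc, h₂]

end Pushout

section Pullback

variable [HasPullbacks M] {ι : P ⥤ Q} {X Y : Q ⥤ M} (f : X ⟶ Y) (r : Q) {LX LY : M}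
  {iX : MatchFamily ι (ι ⋙ X) r LX} (hX : iX.IsUniversal)
  {iY : MatchFamily ι (ι ⋙ Y) r LY} (hY : iY.IsUniversal)
  {m : LX ⟶ LY} (hm : ∀ s g, m ≫ iY.app s g = iX.app s g ≫ f.app (ι.obj s))
  {a : X.obj r ⟶ LX} (ha : ∀ s g, a ≫ iX.app s g = X.map g)
  {b : Y.obj r ⟶ LY} (hb : ∀ s g, b ≫ iY.app s g = Y.map g)
  (w : a ≫ m = f.app r ≫ b)

include hX hY hm ha hb in
lemma hasLiftingProperty_pullbackLift_iff {A B : M} (i : A ⟶ B) :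
    HasLiftingProperty i (pullback.lift a (f.app r) w) ↔ MatchLift ι f r i := by
  constructor
  · intro h φ α β h₁ h₂ h₃
    obtain ⟨d, hd, -⟩ := hX φ
    have hd' : d ≫ m = α ≫ b := hY.hom_ext fun s g ↦ by
      rw [Category.assoc, hm, reassoc_of% hd, h₁, Category.assoc, hb]
    have sq : CommSq β i (pullback.lift a (f.app r) w) (pullback.lift d α hd') := by
      refine ⟨pullback.hom_ext ?_ ?_⟩
      · simp only [Category.assoc, pullback.lift_fst]
        exact hX.hom_ext fun s g ↦ by
          rw [Category.assoc, ha, Category.assoc, hd, h₃]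
      · rw [Category.assoc, Category.assoc, pullback.lift_snd, pullback.lift_snd, h₂]
    refine ⟨sq.lift, fun s g ↦ ?_, ?_, sq.fac_left⟩
    · rw [← ha, ← hd, ← Category.assoc]
      congr 1
      simpa only [Category.assoc, pullback.lift_fst] using sq.fac_right =≫ (pullback.fst m b)
    · simpa only [Category.assoc, pullback.lift_snd] using sq.fac_right =≫ (pullback.snd m b)
  · intro h
    refine ⟨fun {β α'} sq ↦ ?_⟩
    have sqw := sq.w
    obtain ⟨l, h₁, h₂, h₃⟩ := h
      ⟨fun s g ↦ α' ≫ pullback.fst m b ≫ iX.app s g, fun k g ↦ by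
        rw [← iX.naturality k g, Category.assoc, Category.assoc]⟩ (α' ≫ pullback.snd m b) β
      (fun s g ↦ by
        simp only [Category.assoc]
        rw [← hm, pullback.condition_assoc, hb])
      (by simpa only [Category.assoc, pullback.lift_snd] using sqw =≫ (pullback.snd m b))
      (fun s g ↦ by
        have := sqw =≫ (pullback.fst m b ≫ iX.app s g)
        simp only [Category.assoc, pullback.lift_fst_assoc, ha] at this ⊢
        exact this.symm)
    refine ⟨⟨⟨l, h₃, ?_⟩⟩⟩
    refine pullback.hom_ext ?_ ?_
    · rw [Category.assoc, pullback.lift_fst]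
      exact hX.hom_ext fun s g ↦ by rw [Category.assoc, ha, h₁, Category.assoc]
    · rw [Category.assoc, pullback.lift_snd, h₂]

end Pullback

/-- The components of a retract of natural transformations. -/
lemma exists_of_retractArrow {X Y X' Y' : Q ⥤ M} {f : X ⟶ Y} {f' : X' ⟶ Y'}
    (h : RetractArrow f f') :
    ∃ (a : X ⟶ X') (b : X' ⟶ X) (c : Y ⟶ Y') (d : Y' ⟶ Y),
      (∀ q, a.app q ≫ b.app q = 𝟙 _) ∧ (∀ q, c.app q ≫ d.app q = 𝟙 _) ∧
      (∀ q, a.app q ≫ f'.app q = f.app q ≫ c.app q) ∧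
      (∀ q, b.app q ≫ f.app q = f'.app q ≫ d.app q) :=
  ⟨h.i.left, h.r.left, h.i.right, h.r.right, fun q ↦ congr_app h.left.retract q,
    fun q ↦ congr_app h.right.retract q, fun q ↦ congr_app h.i_w q, fun q ↦ congr_app h.r_w q⟩

lemma LatchLift.of_retract {ι : P ⥤ Q} {X Y X' Y' : Q ⥤ M} {f : X ⟶ Y} {f' : X' ⟶ Y'}
    (h : RetractArrow f f') {r : Q} {E B : M} {p : E ⟶ B} (hf' : LatchLift ι f' r p) :
    LatchLift ι f r p := by
  intro φ α β h₁ h₂ h₃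
  obtain ⟨a, b, c, d, hab, hcd, hac, hbd⟩ := exists_of_retractArrow h
  obtain ⟨l, h₄, h₅, h₆⟩ := hf'
    ⟨fun s g ↦ d.app _ ≫ φ.app s g, fun {s t} k g ↦ by
      rw [← φ.naturality k g]
      exact d.naturality_assoc _ _⟩
    (b.app r ≫ α) (d.app r ≫ β)
    (fun s g ↦ by rw [← reassoc_of% hbd, h₁, b.naturality_assoc])
    (by rw [Category.assoc, h₂, reassoc_of% hbd])
    (fun s g ↦ by rw [Category.assoc, h₃, d.naturality_assoc])
  refine ⟨c.app r ≫ l, fun s g ↦ ?_, ?_, ?_⟩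
  · rw [c.naturality_assoc, h₄, reassoc_of% hcd]
  · rw [← reassoc_of% hac, h₅, reassoc_of% hab]
  · rw [Category.assoc, h₆, reassoc_of% hcd]

lemma MatchLift.of_retract {ι : P ⥤ Q} {X Y X' Y' : Q ⥤ M} {f : X ⟶ Y} {f' : X' ⟶ Y'}
    (h : RetractArrow f f') {r : Q} {A B : M} {i : A ⟶ B} (hf' : MatchLift ι f' r i) :
    MatchLift ι f r i := by
  intro φ α β h₁ h₂ h₃
  obtain ⟨a, b, c, d, hab, hcd, hac, hbd⟩ := exists_of_retractArrow h
  obtain ⟨l, h₄, h₅, h₆⟩ := hf'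
    ⟨fun s g ↦ φ.app s g ≫ a.app _, fun {s t} k g ↦ by
      rw [← φ.naturality k g]
      dsimp
      rw [Category.assoc, Category.assoc, a.naturality]⟩
    (α ≫ c.app r) (β ≫ a.app r)
    (fun s g ↦ by rw [Category.assoc, hac, reassoc_of% h₁, Category.assoc, c.naturality])
    (by rw [Category.assoc, hac, reassoc_of% h₂])
    (fun s g ↦ by rw [reassoc_of% h₃, Category.assoc, a.naturality])
  refine ⟨l ≫ b.app r, fun s g ↦ ?_, ?_, ?_⟩
  · rw [Category.assoc, ← b.naturality, reassoc_of% h₄, hab]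
    exact Category.comp_id _
  · rw [Category.assoc, hbd, reassoc_of% h₅, hcd, Category.comp_id]
  · rw [reassoc_of% h₆, hab, Category.comp_id]

end Families

/-! ### Change of the indexing categories -/

section Transfer

variable {P₁ P₂ Q₁ Q₂ : Type*} [Category* P₁] [Category* P₂] [Category* Q₁] [Category* Q₂]
  {M : Type u} [Category.{v} M] {ι₁ : P₁ ⥤ Q₁} {ι₂ : P₂ ⥤ Q₂} {e : P₁ ⥤ P₂} {F : Q₁ ⥤ Q₂}
  [e.Full] [e.EssSurj] [F.Full] [F.Faithful] (θ : ι₁ ⋙ F ≅ e ⋙ ι₂) {X Y : Q₂ ⥤ M}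

include θ in
/-- The lifting condition for relative latching maps only depends on the full subcategory of the
objects over which the families are indexed. -/
lemma latchLift_whiskerLeft_iff (f : X ⟶ Y) (r : Q₁) {E B : M} (p : E ⟶ B) :
    LatchLift ι₁ (Functor.whiskerLeft F f) r p ↔ LatchLift ι₂ f (F.obj r) p := by
  constructor
  · intro h φ α β h₁ h₂ h₃
    obtain ⟨l, h₄, h₅, h₆⟩ := h
      ⟨fun s g ↦ Y.map (θ.hom.app s) ≫ φ.app (e.obj s) (θ.inv.app s ≫ F.map g),
        fun {s t} k g ↦ by
          have := φ.naturality (e.map k) (θ.inv.app t ≫ F.map g)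
          have hθ := θ.inv.naturality k
          dsimp at this hθ ⊢
          rw [reassoc_of% hθ, ← F.map_comp] at this
          rw [← this, ← Y.map_comp_assoc, ← Y.map_comp_assoc]
          congr 2
          exact θ.hom.naturality k⟩
      α β
      (fun s g ↦ by
        dsimp
        rw [← f.naturality_assoc, h₁, ← X.map_comp_assoc, Iso.hom_inv_id_app_assoc])
      h₂
      (fun s g ↦ by
        dsimp
        rw [Category.assoc, h₃, ← Y.map_comp_assoc, Iso.hom_inv_id_app_assoc])
    refine ⟨l, fun s g ↦ ?_, h₅, h₆⟩
    let k : e.obj (e.objPreimage s) ≅ s := e.objObjPreimageIso s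
    let g₁ := F.preimage (θ.hom.app _ ≫ ι₂.map k.hom ≫ g)
    have h₇ := h₄ _ g₁
    have h₈ := φ.naturality k.hom g
    dsimp at h₇ h₈
    simp only [g₁, F.map_preimage, Iso.inv_hom_id_app_assoc] at h₇
    rw [← cancel_epi (Y.map (ι₂.map k.hom)), ← cancel_epi (Y.map (θ.hom.app _))]
    erw [h₈, ← h₇]
    simp
  · intro h φ α β h₁ h₂ h₃
    let k : ∀ s, e.obj (e.objPreimage s) ≅ s := fun s ↦ e.objObjPreimageIso s
    let c : ∀ s, F.obj (ι₁.obj (e.objPreimage s)) ≅ ι₂.obj s :=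
      fun s ↦ θ.app _ ≪≫ ι₂.mapIso (k s)
    -- naturality of `φ` along morphisms which come from `P₂`
    have key : ∀ (s t : P₁) (x : ι₂.obj (e.obj s) ⟶ ι₂.obj (e.obj t))
        (hx : ∃ x', x = ι₂.map x') (g : F.obj (ι₁.obj t) ⟶ F.obj r),
        Y.map (θ.hom.app s ≫ x ≫ θ.inv.app t) ≫ φ.app t (F.preimage g) =
          φ.app s (F.preimage (θ.hom.app s ≫ x ≫ θ.inv.app t ≫ g)) := by
      rintro s t _ ⟨x, rfl⟩ g
      obtain ⟨x, rfl⟩ := e.map_surjective x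
      have h₄ := φ.naturality x (F.preimage g)
      have h₅ := θ.hom.naturality x
      dsimp at h₄ h₅ ⊢
      rw [← reassoc_of% h₅, ← reassoc_of% h₅, Iso.hom_inv_id_app_assoc, Iso.hom_inv_id_app]
      erw [Category.comp_id]
      rw [h₄]
      congr 1
      apply F.map_injective
      simp
    obtain ⟨l, h₄, h₅, h₆⟩ := h
      ⟨fun s g ↦ Y.map (c s).inv ≫ φ.app (e.objPreimage s) (F.preimage ((c s).hom ≫ g)),
        fun {s t} x g ↦ by
          have := key (e.objPreimage s) (e.objPreimage t)
            (ι₂.map ((k s).hom ≫ x ≫ (k t).inv)) ⟨_, rfl⟩ ((c t).hom ≫ g)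
          dsimp
          rw [← cancel_epi (Y.map (c s).hom), ← Y.map_comp_assoc, ← Y.map_comp_assoc,
            ← Y.map_comp_assoc, Iso.hom_inv_id, Y.map_id, Category.id_comp]
          simp only [Functor.map_comp, c, Iso.trans_hom, Iso.trans_inv, Functor.mapIso_hom,
            Functor.mapIso_inv, Iso.app_hom, Iso.app_inv, Category.assoc,
            Iso.inv_hom_id_app_assoc, Iso.map_inv_hom_id_assoc] at this ⊢
          exact this⟩
      α β
      (fun s g ↦ by
        dsimp
        rw [← f.naturality_assoc]
        have := h₁ _ (F.preimage ((c s).hom ≫ g))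
        dsimp at this
        rw [this, F.map_preimage, ← X.map_comp_assoc, Iso.inv_hom_id_assoc])
      h₂
      (fun s g ↦ by
        have := h₃ _ (F.preimage ((c s).hom ≫ g))
        dsimp at this ⊢
        rw [Category.assoc, this, F.map_preimage, ← Y.map_comp_assoc, Iso.inv_hom_id_assoc])
    refine ⟨l, fun s g ↦ ?_, h₅, h₆⟩
    have h₇ := h₄ (e.obj s) (θ.inv.app s ≫ F.map g)
    have h₈ := key (e.objPreimage (e.obj s)) s (ι₂.map (k _).hom) ⟨_, rfl⟩ (F.map g)
    dsimp at h₇ ⊢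
    rw [← cancel_epi (Y.map (θ.inv.app s)), ← Y.map_comp_assoc, h₇,
      ← cancel_epi (Y.map (c _).hom)]
    rw [← Y.map_comp_assoc, ← Y.map_comp_assoc, Iso.hom_inv_id, Y.map_id, Category.id_comp]
    simp only [c, Iso.trans_hom, Iso.app_hom, Functor.mapIso_hom, Category.assoc] at h₈ ⊢
    rw [← h₈, F.preimage_map]

include θ in
/-- The lifting condition for relative matching maps only depends on the full subcategory of the
objects over which the families are indexed. -/
lemma matchLift_whiskerLeft_iff (f : X ⟶ Y) (r : Q₁) {A B : M} (i : A ⟶ B) :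
    MatchLift ι₁ (Functor.whiskerLeft F f) r i ↔ MatchLift ι₂ f (F.obj r) i := by
  constructor
  · intro h φ α β h₁ h₂ h₃
    obtain ⟨l, h₄, h₅, h₆⟩ := h
      ⟨fun s g ↦ φ.app (e.obj s) (F.map g ≫ θ.hom.app s) ≫ X.map (θ.inv.app s),
        fun {s t} k g ↦ by
          have := φ.naturality (e.map k) (F.map g ≫ θ.hom.app s)
          have hθ := θ.hom.naturality k
          dsimp at this hθ ⊢
          rw [Category.assoc, ← hθ, ← F.map_comp_assoc] at this
          rw [← this, Category.assoc, Category.assoc, ← X.map_comp, ← X.map_comp]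
          congr 2
          exact (θ.inv.naturality k).symm⟩
      α β
      (fun s g ↦ by
        dsimp
        rw [Category.assoc, f.naturality, reassoc_of% h₁, ← Y.map_comp, Category.assoc,
          Iso.hom_inv_id_app]
        erw [Category.comp_id])
      h₂
      (fun s g ↦ by
        dsimp
        rw [reassoc_of% h₃, ← X.map_comp, Category.assoc, Iso.hom_inv_id_app]
        erw [Category.comp_id])
    refine ⟨l, fun s g ↦ ?_, h₅, h₆⟩
    let k : e.obj (e.objPreimage s) ≅ s := e.objObjPreimageIso s
    let g₁ := F.preimage (g ≫ ι₂.map k.inv ≫ θ.inv.app _)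
    have h₇ := h₄ _ g₁
    have h₈ := φ.naturality k.inv g
    dsimp at h₇ h₈
    simp only [g₁, F.map_preimage, Category.assoc, Iso.inv_hom_id_app] at h₇
    erw [Category.comp_id] at h₇
    rw [← cancel_mono (X.map (ι₂.map k.inv)), ← cancel_mono (X.map (θ.inv.app _))]
    erw [h₈, ← h₇]
    simp
  · intro h φ α β h₁ h₂ h₃
    let k : ∀ s, e.obj (e.objPreimage s) ≅ s := fun s ↦ e.objObjPreimageIso s
    let c : ∀ s, F.obj (ι₁.obj (e.objPreimage s)) ≅ ι₂.obj s :=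
      fun s ↦ θ.app _ ≪≫ ι₂.mapIso (k s)
    -- naturality of `φ` along morphisms which come from `P₂`
    have key : ∀ (s t : P₁) (x : ι₂.obj (e.obj s) ⟶ ι₂.obj (e.obj t))
        (hx : ∃ x', x = ι₂.map x') (g : F.obj r ⟶ F.obj (ι₁.obj s)),
        φ.app s (F.preimage g) ≫ X.map (θ.hom.app s ≫ x ≫ θ.inv.app t) =
          φ.app t (F.preimage (g ≫ θ.hom.app s ≫ x ≫ θ.inv.app t)) := by
      rintro s t _ ⟨x, rfl⟩ g
      obtain ⟨x, rfl⟩ := e.map_surjective x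
      have h₄ := φ.naturality x (F.preimage g)
      have h₅ := θ.hom.naturality x
      dsimp at h₄ h₅ ⊢
      rw [← reassoc_of% h₅, Iso.hom_inv_id_app]
      erw [Category.comp_id]
      rw [h₄]
      congr 1
      apply F.map_injective
      simp
    obtain ⟨l, h₄, h₅, h₆⟩ := h
      ⟨fun s g ↦ φ.app (e.objPreimage s) (F.preimage (g ≫ (c s).inv)) ≫ X.map (c s).hom,
        fun {s t} x g ↦ by
          have := key (e.objPreimage s) (e.objPreimage t)
            (ι₂.map ((k s).hom ≫ x ≫ (k t).inv)) ⟨_, rfl⟩ (g ≫ (c s).inv)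
          dsimp
          rw [← cancel_mono (X.map (c t).inv), Category.assoc, Category.assoc, Category.assoc,
            ← X.map_comp, ← X.map_comp, ← X.map_comp, Iso.hom_inv_id, X.map_id,
            Category.comp_id]
          simp only [Functor.map_comp, c, Iso.trans_hom, Iso.trans_inv, Functor.mapIso_hom,
            Functor.mapIso_inv, Iso.app_hom, Iso.app_inv, Category.assoc,
            Iso.inv_hom_id_app_assoc, Iso.map_inv_hom_id_assoc] at this ⊢
          exact this⟩
      α β
      (fun s g ↦ by
        dsimp
        rw [Category.assoc, f.naturality]
        have := h₁ _ (F.preimage (g ≫ (c s).inv))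
        dsimp at this
        rw [reassoc_of% this, F.map_preimage, ← Y.map_comp, Category.assoc, Iso.inv_hom_id,
          Category.comp_id])
      h₂
      (fun s g ↦ by
        have := h₃ _ (F.preimage (g ≫ (c s).inv))
        dsimp at this ⊢
        rw [reassoc_of% this, F.map_preimage, ← X.map_comp, Category.assoc, Iso.inv_hom_id,
          Category.comp_id])
    refine ⟨l, fun s g ↦ ?_, h₅, h₆⟩
    have h₇ := h₄ (e.obj s) (F.map g ≫ θ.hom.app s)
    have h₈ := key s (e.objPreimage (e.obj s)) (ι₂.map (k _).inv) ⟨_, rfl⟩ (F.map g)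
    dsimp at h₇ ⊢
    rw [← cancel_mono (X.map (θ.hom.app s)), Category.assoc, ← X.map_comp, h₇,
      ← cancel_mono (X.map (c _).inv)]
    rw [Category.assoc, ← X.map_comp, Iso.hom_inv_id, X.map_id, Category.comp_id]
    simp only [c, Iso.trans_inv, Iso.app_inv, Functor.mapIso_inv, Category.assoc] at h₈ ⊢
    rw [← h₈, F.preimage_map]
    simp

end Transfer

/-! ### Latching and matching objects of a functor -/

section Universal

variable {P : Type*} [Category* P] {Q : Type*} [Category* Q] {M : Type u} [Category.{v} M]
  {ι : P ⥤ Q} {Z Z' : P ⥤ M} {r : Q}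

/-- Postcomposition of a family `Z_s ⟶ E` with a map `E ⟶ E'`. -/
@[simps]
def LatchFamily.postcomp {E E' : M} (φ : LatchFamily ι Z r E) (k : E ⟶ E') :
    LatchFamily ι Z r E' where
  app s g := φ.app s g ≫ k
  naturality k' g := by rw [← φ.naturality k' g, Category.assoc]

/-- Precomposition of a family `Z'_s ⟶ E` with a natural transformation `Z ⟶ Z'`. -/
@[simps]
def LatchFamily.precomp {E : M} (φ : LatchFamily ι Z' r E) (f : Z ⟶ Z') :
    LatchFamily ι Z r E where
  app s g := f.app s ≫ φ.app s g
  naturality k g := by rw [← φ.naturality k g, f.naturality_assoc]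

/-- The family `X_g : X_{ι s} ⟶ X_r` of a functor `X`. -/
@[simps]
def LatchFamily.ofFunctor (ι : P ⥤ Q) (X : Q ⥤ M) (r : Q) :
    LatchFamily ι (ι ⋙ X) r (X.obj r) where
  app s g := X.map g
  naturality k g := by simp

/-- Precomposition of a family `A ⟶ Z_s` with a map `A' ⟶ A`. -/
@[simps]
def MatchFamily.precomp {A A' : M} (φ : MatchFamily ι Z r A) (k : A' ⟶ A) :
    MatchFamily ι Z r A' where
  app s g := k ≫ φ.app s g
  naturality k' g := by rw [← φ.naturality k' g, Category.assoc]

/-- Postcomposition of a family `A ⟶ Z_s` with a natural transformation `Z ⟶ Z'`. -/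
@[simps]
def MatchFamily.postcomp {A : M} (φ : MatchFamily ι Z r A) (f : Z ⟶ Z') :
    MatchFamily ι Z' r A where
  app s g := φ.app s g ≫ f.app s
  naturality k g := by rw [← φ.naturality k g, Category.assoc, Category.assoc, f.naturality]

/-- The family `X_g : X_r ⟶ X_{ι s}` of a functor `X`. -/
@[simps]
def MatchFamily.ofFunctor (ι : P ⥤ Q) (X : Q ⥤ M) (r : Q) :
    MatchFamily ι (ι ⋙ X) r (X.obj r) where
  app s g := X.map g
  naturality k g := by simp

/-- The map out of a universal family which is determined by another family. -/
noncomputable def LatchFamily.IsUniversal.desc {L E : M} {φ : LatchFamily ι Z r L}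
    (hφ : φ.IsUniversal) (ψ : LatchFamily ι Z r E) : L ⟶ E :=
  (hφ ψ).choose

lemma LatchFamily.IsUniversal.fac {L E : M} {φ : LatchFamily ι Z r L}
    (hφ : φ.IsUniversal) (ψ : LatchFamily ι Z r E) (s : P) (g : ι.obj s ⟶ r) :
    φ.app s g ≫ hφ.desc ψ = ψ.app s g :=
  (hφ ψ).choose_spec.1 s g

/-- The map into a universal family which is determined by another family. -/
noncomputable def MatchFamily.IsUniversal.lift {L A : M} {φ : MatchFamily ι Z r L}
    (hφ : φ.IsUniversal) (ψ : MatchFamily ι Z r A) : A ⟶ L :=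
  (hφ ψ).choose

lemma MatchFamily.IsUniversal.fac {L A : M} {φ : MatchFamily ι Z r L}
    (hφ : φ.IsUniversal) (ψ : MatchFamily ι Z r A) (s : P) (g : r ⟶ ι.obj s) :
    hφ.lift ψ ≫ φ.app s g = ψ.app s g :=
  (hφ ψ).choose_spec.1 s g

end Universal

section Objects

variable {P : Type w} [SmallCategory P] {Q : Type w} [SmallCategory Q]
  {M : Type u} [Category.{v} M]

section Latch

variable [HasColimitsOfSize.{w, w} M] (ι : P ⥤ Q)

/-- The latching object at `r` of a functor `Z` which is defined on `P` only: the value at `r` of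
the left Kan extension of `Z` along `ι`. -/
noncomputable def latch (Z : P ⥤ M) (r : Q) : M :=
  colimit (CostructuredArrow.proj ι r ⋙ Z)

/-- The universal family on the latching object. -/
noncomputable def latchInj (Z : P ⥤ M) (r : Q) : LatchFamily ι Z r (latch ι Z r) where
  app s g := colimit.ι (CostructuredArrow.proj ι r ⋙ Z) (CostructuredArrow.mk g)
  naturality {s t} k g :=
    colimit.w (CostructuredArrow.proj ι r ⋙ Z) (CostructuredArrow.homMk (f := .mk (ι.map k ≫ g))
      (f' := .mk g) k)

lemma latchInj_isUniversal (Z : P ⥤ M) (r : Q) : (latchInj ι Z r).IsUniversal := by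
  intro E ψ
  refine ⟨colimit.desc (CostructuredArrow.proj ι r ⋙ Z)
    { pt := E
      ι :=
        { app c := ψ.app c.left c.hom
          naturality c c' k := by
            have := ψ.naturality k.left c'.hom
            rw [CostructuredArrow.w k] at this
            exact this.trans (Category.comp_id _).symm } }, fun s g ↦ ?_, fun d hd ↦ ?_⟩
  · exact colimit.ι_desc (F := CostructuredArrow.proj ι r ⋙ Z) _ _
  · refine colimit.hom_ext fun c ↦ ?_
    rw [colimit.ι_desc]
    exact hd c.left c.hom

variable {ι}

/-- The map of latching objects induced by a natural transformation. -/
noncomputable def latchMap {Z Z' : P ⥤ M} (f : Z ⟶ Z') (r : Q) : latch ι Z r ⟶ latch ι Z' r :=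
  (latchInj_isUniversal ι Z r).desc ((latchInj ι Z' r).precomp f)

lemma latchInj_latchMap {Z Z' : P ⥤ M} (f : Z ⟶ Z') (r : Q) (s : P) (g : ι.obj s ⟶ r) :
    (latchInj ι Z r).app s g ≫ latchMap f r = f.app s ≫ (latchInj ι Z' r).app s g :=
  (latchInj_isUniversal ι Z r).fac _ s g

variable (ι)

/-- The canonical map from the latching object of a functor on `Q` to its value. -/
noncomputable def latchTo (X : Q ⥤ M) (r : Q) : latch ι (ι ⋙ X) r ⟶ X.obj r :=
  (latchInj_isUniversal ι (ι ⋙ X) r).desc (.ofFunctor ι X r)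

lemma latchInj_latchTo (X : Q ⥤ M) (r : Q) (s : P) (g : ι.obj s ⟶ r) :
    (latchInj ι (ι ⋙ X) r).app s g ≫ latchTo ι X r = X.map g :=
  (latchInj_isUniversal ι (ι ⋙ X) r).fac _ s g

lemma latchMap_latchTo {X Y : Q ⥤ M} (f : X ⟶ Y) (r : Q) :
    latchMap (Functor.whiskerLeft ι f) r ≫ latchTo ι Y r = latchTo ι X r ≫ f.app r :=
  (latchInj_isUniversal ι (ι ⋙ X) r).hom_ext fun s g ↦ by
    rw [reassoc_of% latchInj_latchMap, latchInj_latchTo, reassoc_of% latchInj_latchTo]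
    simp

/-- The relative latching map of `f` at `r`. -/
noncomputable def relLatch [HasPushouts M] {X Y : Q ⥤ M} (f : X ⟶ Y) (r : Q) :
    pushout (latchMap (Functor.whiskerLeft ι f) r) (latchTo ι X r) ⟶ Y.obj r :=
  pushout.desc (latchTo ι Y r) (f.app r) (latchMap_latchTo ι f r)

lemma hasLiftingProperty_relLatch_iff [HasPushouts M] {X Y : Q ⥤ M} (f : X ⟶ Y) (r : Q)
    {E B : M} (p : E ⟶ B) : HasLiftingProperty (relLatch ι f r) p ↔ LatchLift ι f r p :=
  hasLiftingProperty_pushoutDesc_iff f r (latchInj_isUniversal ι _ r)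
    (latchInj_isUniversal ι _ r) (latchInj_latchMap _ r) (latchInj_latchTo ι X r)
    (latchInj_latchTo ι Y r) _ p

end Latch

section Match

variable [HasLimitsOfSize.{w, w} M] (ι : P ⥤ Q)

/-- The matching object at `r` of a functor `Z` which is defined on `P` only: the value at `r` of
the right Kan extension of `Z` along `ι`. -/
noncomputable def matching (Z : P ⥤ M) (r : Q) : M :=
  limit (StructuredArrow.proj r ι ⋙ Z)

/-- The universal family on the matching object. -/
noncomputable def matchProj (Z : P ⥤ M) (r : Q) : MatchFamily ι Z r (matching ι Z r) where
  app s g := limit.π (StructuredArrow.proj r ι ⋙ Z) (StructuredArrow.mk g)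
  naturality {s t} k g :=
    limit.w (StructuredArrow.proj r ι ⋙ Z) (StructuredArrow.homMk (f := .mk g)
      (f' := .mk (g ≫ ι.map k)) k)

lemma matchProj_isUniversal (Z : P ⥤ M) (r : Q) : (matchProj ι Z r).IsUniversal := by
  intro A ψ
  refine ⟨limit.lift (StructuredArrow.proj r ι ⋙ Z)
    { pt := A
      π :=
        { app c := ψ.app c.right c.hom
          naturality c c' k := by
            have := ψ.naturality k.right c.hom
            rw [StructuredArrow.w k] at this
            exact (Category.id_comp _).trans this.symm } }, fun s g ↦ ?_, fun d hd ↦ ?_⟩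
  · exact limit.lift_π _ _
  · refine limit.hom_ext fun c ↦ ?_
    rw [limit.lift_π]
    exact hd c.right c.hom

variable {ι}

/-- The map of matching objects induced by a natural transformation. -/
noncomputable def matchMap {Z Z' : P ⥤ M} (f : Z ⟶ Z') (r : Q) :
    matching ι Z r ⟶ matching ι Z' r :=
  (matchProj_isUniversal ι Z' r).lift ((matchProj ι Z r).postcomp f)

lemma matchMap_matchProj {Z Z' : P ⥤ M} (f : Z ⟶ Z') (r : Q) (s : P) (g : r ⟶ ι.obj s) :
    matchMap f r ≫ (matchProj ι Z' r).app s g = (matchProj ι Z r).app s g ≫ f.app s :=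
  (matchProj_isUniversal ι Z' r).fac _ s g

variable (ι)

/-- The canonical map from the value of a functor on `Q` to its matching object. -/
noncomputable def toMatch (X : Q ⥤ M) (r : Q) : X.obj r ⟶ matching ι (ι ⋙ X) r :=
  (matchProj_isUniversal ι (ι ⋙ X) r).lift (.ofFunctor ι X r)

lemma toMatch_matchProj (X : Q ⥤ M) (r : Q) (s : P) (g : r ⟶ ι.obj s) :
    toMatch ι X r ≫ (matchProj ι (ι ⋙ X) r).app s g = X.map g :=
  (matchProj_isUniversal ι (ι ⋙ X) r).fac _ s g

lemma toMatch_matchMap {X Y : Q ⥤ M} (f : X ⟶ Y) (r : Q) :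
    toMatch ι X r ≫ matchMap (Functor.whiskerLeft ι f) r = f.app r ≫ toMatch ι Y r :=
  (matchProj_isUniversal ι (ι ⋙ Y) r).hom_ext fun s g ↦ by
    rw [Category.assoc, matchMap_matchProj, Category.assoc, toMatch_matchProj,
      reassoc_of% toMatch_matchProj]
    simp

/-- The relative matching map of `f` at `r`. -/
noncomputable def relMatch [HasPullbacks M] {X Y : Q ⥤ M} (f : X ⟶ Y) (r : Q) :
    X.obj r ⟶ pullback (matchMap (Functor.whiskerLeft ι f) r) (toMatch ι Y r) :=
  pullback.lift (toMatch ι X r) (f.app r) (toMatch_matchMap ι f r)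

lemma hasLiftingProperty_relMatch_iff [HasPullbacks M] {X Y : Q ⥤ M} (f : X ⟶ Y) (r : Q)
    {A B : M} (i : A ⟶ B) : HasLiftingProperty i (relMatch ι f r) ↔ MatchLift ι f r i :=
  hasLiftingProperty_pullbackLift_iff f r (matchProj_isUniversal ι _ r)
    (matchProj_isUniversal ι _ r) (matchMap_matchProj _ r) (toMatch_matchProj ι X r)
    (toMatch_matchProj ι Y r) _ i

end Match

end Objects

/-! ### Gluing objects to a full subcategory -/

section Glue

variable {P : Type w} [SmallCategory P] {C : Type w} [SmallCategory C] {D : Type w}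

/-- The full subcategory of `C` spanned by the images of `ι : P ⥤ C` and `d : D → C`, with the
disjoint union of `P` and `D` as its type of objects. -/
inductive Glue (ι : P ⥤ C) (d : D → C) : Type w
  /-- an object of `P` -/
  | low (p : P) : Glue ι d
  /-- an object of `D` -/
  | top (x : D) : Glue ι d

namespace Glue

variable (ι : P ⥤ C) (d : D → C)

variable {ι d} in
/-- The object of `C` underlying an object of `Glue ι d`. -/
@[reducible]
def pt : Glue ι d → C
  | low p => ι.obj p
  | top x => d x

instance : SmallCategory (Glue ι d) :=
  inferInstanceAs (Category (InducedCategory C (pt (ι := ι) (d := d))))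

variable {ι d} in
/-- A morphism of `Glue ι d` is a morphism of `C`. -/
def homMk {a b : Glue ι d} (f : a.pt ⟶ b.pt) : a ⟶ b := InducedCategory.homMk f

/-- The fully faithful functor to `C`. -/
def toBase : Glue ι d ⥤ C := inducedFunctor pt

instance : (toBase ι d).Full := InducedCategory.full _
instance : (toBase ι d).Faithful := InducedCategory.faithful _

/-- The inclusion of `P`. -/
def inl : P ⥤ Glue ι d where
  obj p := low p
  map k := homMk (ι.map k)
  map_id p := InducedCategory.hom_ext (ι.map_id p)
  map_comp k k' := InducedCategory.hom_ext (ι.map_comp k k')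

instance [ι.Full] : (inl ι d).Full where
  map_surjective f :=
    ⟨ι.preimage ((toBase ι d).map f), InducedCategory.hom_ext (ι.map_preimage _)⟩

instance [ι.Faithful] : (inl ι d).Faithful where
  map_injective h := ι.map_injective (congrArg (toBase ι d).map h)

/-- The conditions under which a functor on `Glue ι d` amounts to its restriction to `P` and, for
every `x : D`, a factorization through its value of the map from the latching to the matching
object: between objects of `D` there are the identities, which do not factor through `P`, and
morphisms which factor through `P`, any two factorizations being connected by a zigzag. -/
structure IsReedyLike : Prop where
  eq_or_fac {x y : D} (f : (top x : Glue ι d) ⟶ top y) :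
    (∃ h : x = y, f = eqToHom (congrArg top h)) ∨
      ∃ (p : P) (g : top x ⟶ (inl ι d).obj p) (h : (inl ι d).obj p ⟶ top y), g ≫ h = f
  comp_ne_id {x : D} {p : P} (g : top x ⟶ (inl ι d).obj p) (h : (inl ι d).obj p ⟶ top x) :
    g ≫ h ≠ 𝟙 _
  zigzag {x y : D} {p : P} (g : top x ⟶ (inl ι d).obj p) (h : (inl ι d).obj p ⟶ top y) :
    ∃ (p₀ : P) (g₀ : top x ⟶ (inl ι d).obj p₀) (h₀ : (inl ι d).obj p₀ ⟶ top y),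
      ∀ (p' : P) (g' : top x ⟶ (inl ι d).obj p') (h' : (inl ι d).obj p' ⟶ top y),
        g' ≫ h' = g ≫ h → ∃ (p₁ : P) (g₁ : top x ⟶ (inl ι d).obj p₁) (a : p₁ ⟶ p') (b : p₁ ⟶ p₀),
          g₁ ≫ (inl ι d).map a = g' ∧ g₁ ≫ (inl ι d).map b = g₀ ∧
            (inl ι d).map a ≫ h' = (inl ι d).map b ≫ h₀

variable {ι d} {M : Type u} [Category.{v} M]

/-- The composite `A ⟶ Z_p ⟶ E` of two families only depends on the morphism of `D` which is
factored through `p`; this makes the action of an extension on such morphisms well defined. -/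
lemma IsReedyLike.comp_eq (hR : IsReedyLike ι d) {Z : P ⥤ M} {x y : D} {A E : M}
    (α : MatchFamily (inl ι d) Z (top x) A) (φ : LatchFamily (inl ι d) Z (top y) E) {p p' : P}
    (g : top x ⟶ (inl ι d).obj p) (h : (inl ι d).obj p ⟶ top y)
    (g' : top x ⟶ (inl ι d).obj p') (h' : (inl ι d).obj p' ⟶ top y) (w : g ≫ h = g' ≫ h') :
    α.app p g ≫ φ.app p h = α.app p' g' ≫ φ.app p' h' := by
  obtain ⟨p₀, g₀, h₀, H⟩ := hR.zigzag g h
  have key : ∀ (q : P) (k : top x ⟶ (inl ι d).obj q) (l : (inl ι d).obj q ⟶ top y),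
      k ≫ l = g ≫ h → α.app q k ≫ φ.app q l = α.app p₀ g₀ ≫ φ.app p₀ h₀ := by
    intro q k l hkl
    obtain ⟨p₁, g₁, a, b, rfl, rfl, hab⟩ := H q k l hkl
    rw [← α.naturality, ← α.naturality, Category.assoc, Category.assoc, φ.naturality,
      φ.naturality, hab]
  rw [key p g h rfl, key p' g' h' w.symm]

/-- Natural transformations of functors on `Glue ι d` need only be checked for naturality with
respect to morphisms between `P` and `D`. -/
def natTransMk (hR : IsReedyLike ι d) [ι.Full] {X Y : Glue ι d ⥤ M}
    (τ : inl ι d ⋙ X ⟶ inl ι d ⋙ Y) (σ : ∀ x, X.obj (top x) ⟶ Y.obj (top x))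
    (hτσ : ∀ p x (g : (inl ι d).obj p ⟶ top x), X.map g ≫ σ x = τ.app p ≫ Y.map g)
    (hστ : ∀ p x (g : top x ⟶ (inl ι d).obj p), X.map g ≫ τ.app p = σ x ≫ Y.map g) : X ⟶ Y where
  app
    | low p => τ.app p
    | top x => σ x
  naturality := by
    rintro (p | x) (q | y) f
    · obtain ⟨k, rfl⟩ := (inl ι d).map_surjective f
      exact τ.naturality k
    · exact hτσ p y f
    · exact hστ q x f
    · obtain ⟨rfl, rfl⟩ | ⟨p, g, h, rfl⟩ := hR.eq_or_fac f
      · simp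
      · dsimp
        rw [X.map_comp, Y.map_comp, Category.assoc, hτσ, reassoc_of% (hστ p x g)]

variable (ι d) in
/-- The data needed to extend a functor `Z` from `P` to `Glue ι d`: for every `x : D` an object with
maps from and to the objects `Z_p`. -/
structure ExtensionData (Z : P ⥤ M) [ι.Full] where
  /-- the value at `x` -/
  obj (x : D) : M
  /-- the maps from the objects `Z_p` -/
  fromLow (x : D) : LatchFamily (inl ι d) Z (top x) (obj x)
  /-- the maps to the objects `Z_p` -/
  toLow (x : D) : MatchFamily (inl ι d) Z (top x) (obj x)
  fac (x : D) {p q : P} (g : (inl ι d).obj p ⟶ top x) (h : top x ⟶ (inl ι d).obj q) :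
    (fromLow x).app p g ≫ (toLow x).app q h = Z.map ((inl ι d).preimage (g ≫ h))

namespace ExtensionData

variable [ι.Full] {Z : P ⥤ M} (E : ExtensionData ι d Z) (hR : IsReedyLike ι d)

open Classical in
/-- The action of the extension on the morphisms between objects of `D`. -/
noncomputable def mapTop {x y : D} (f : (top x : Glue ι d) ⟶ top y) : E.obj x ⟶ E.obj y :=
  if H : ∃ (p : P) (g : top x ⟶ (inl ι d).obj p) (h : (inl ι d).obj p ⟶ top y), g ≫ h = f then
    (E.toLow x).app _ H.choose_spec.choose ≫ (E.fromLow y).app _ H.choose_spec.choose_spec.choose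
  else eqToHom (congrArg E.obj ((hR.eq_or_fac f).resolve_right H).1)

lemma mapTop_comp {x y : D} {p : P} (g : top x ⟶ (inl ι d).obj p)
    (h : (inl ι d).obj p ⟶ top y) :
    E.mapTop hR (g ≫ h) = (E.toLow x).app p g ≫ (E.fromLow y).app p h := by
  have H : ∃ (q : P) (g' : top x ⟶ (inl ι d).obj q) (h' : (inl ι d).obj q ⟶ top y),
    g' ≫ h' = g ≫ h := ⟨p, g, h, rfl⟩
  rw [mapTop, dif_pos H]
  exact hR.comp_eq _ _ _ _ _ _ H.choose_spec.choose_spec.choose_spec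

lemma mapTop_id (x : D) : E.mapTop hR (𝟙 (top x : Glue ι d)) = 𝟙 _ := by
  rw [mapTop, dif_neg]
  · simp
  · rintro ⟨p, g, h, H⟩
    exact hR.comp_ne_id g h H

/-- The values of the extension. -/
@[reducible]
def extObj : Glue ι d → M
  | low p => Z.obj p
  | top x => E.obj x

/-- The action of the extension on morphisms. -/
noncomputable def extMap : ∀ {a b : Glue ι d}, (a ⟶ b) → (E.extObj a ⟶ E.extObj b)
  | low _, low _, f => Z.map ((inl ι d).preimage f)
  | low p, top y, f => (E.fromLow y).app p f
  | top x, low q, f => (E.toLow x).app q f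
  | top _, top _, f => E.mapTop hR f

variable [ι.Faithful]

lemma extMap_comp {a b c : Glue ι d} (f : a ⟶ b) (f' : b ⟶ c) :
    E.extMap hR (f ≫ f') = E.extMap hR f ≫ E.extMap hR f' := by
  have hP : ∀ {p q : P} (k : p ⟶ q), (inl ι d).preimage ((inl ι d).map k) = k :=
    fun k ↦ (inl ι d).preimage_map k
  -- compatibility of `fromLow` and `toLow` with the morphisms between objects of `D`
  have from_top : ∀ {p : P} {y z : D} (f : (inl ι d).obj p ⟶ top y) (f' : top y ⟶ top z),
      (E.fromLow z).app p (f ≫ f') = (E.fromLow y).app p f ≫ E.mapTop hR f' := by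
    intro p y z f f'
    obtain ⟨rfl, rfl⟩ | ⟨q, g, h, rfl⟩ := hR.eq_or_fac f'
    · simp [mapTop_id]
    · rw [mapTop_comp, ← Category.assoc, ← Category.assoc, E.fac, (E.fromLow z).naturality,
        (inl ι d).map_preimage]
  have to_top : ∀ {x y : D} {q : P} (f : (top x : Glue ι d) ⟶ top y)
      (f' : top y ⟶ (inl ι d).obj q),
      (E.toLow x).app q (f ≫ f') = E.mapTop hR f ≫ (E.toLow y).app q f' := by
    intro x y q f f'
    obtain ⟨rfl, rfl⟩ | ⟨p, g, h, rfl⟩ := hR.eq_or_fac f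
    · simp [mapTop_id]
    · rw [mapTop_comp, Category.assoc, Category.assoc, E.fac, (E.toLow x).naturality,
        (inl ι d).map_preimage]
  obtain p | x := a <;> obtain q | y := b <;> obtain r | z := c
  · obtain ⟨k, rfl⟩ := (inl ι d).map_surjective f
    obtain ⟨k', rfl⟩ := (inl ι d).map_surjective f'
    change Z.map ((inl ι d).preimage ((inl ι d).map k ≫ (inl ι d).map k')) =
      Z.map ((inl ι d).preimage ((inl ι d).map k)) ≫
        Z.map ((inl ι d).preimage ((inl ι d).map k'))
    rw [← (inl ι d).map_comp, hP, hP, hP, Z.map_comp]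
  · obtain ⟨k, rfl⟩ := (inl ι d).map_surjective f
    change _ = Z.map ((inl ι d).preimage ((inl ι d).map k)) ≫ _
    rw [hP]
    exact ((E.fromLow z).naturality k f').symm
  · exact (E.fac y f f').symm
  · exact from_top f f'
  · obtain ⟨k, rfl⟩ := (inl ι d).map_surjective f'
    change _ = _ ≫ Z.map ((inl ι d).preimage ((inl ι d).map k))
    rw [hP]
    exact ((E.toLow x).naturality k f).symm
  · exact E.mapTop_comp hR f f'
  · exact to_top f f'
  · obtain ⟨rfl, rfl⟩ | ⟨q, g, h, rfl⟩ := hR.eq_or_fac f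
    · change E.mapTop hR _ = E.mapTop hR _ ≫ E.mapTop hR _
      simp [mapTop_id]
    · change E.mapTop hR _ = E.mapTop hR _ ≫ E.mapTop hR _
      rw [Category.assoc, mapTop_comp, mapTop_comp, Category.assoc, from_top]

/-- The extension of `Z` to `Glue ι d`. -/
noncomputable def functor : Glue ι d ⥤ M where
  obj := E.extObj
  map := E.extMap hR
  map_id := by
    rintro (p | x)
    · change Z.map ((inl ι d).preimage (𝟙 ((inl ι d).obj p))) = 𝟙 _
      rw [← (inl ι d).map_id, (inl ι d).preimage_map, Z.map_id]
    · exact E.mapTop_id hR x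
  map_comp := E.extMap_comp hR

/-- The extension of `Z` restricts to `Z`. -/
noncomputable def restrictIso : inl ι d ⋙ E.functor hR ≅ Z :=
  NatIso.ofComponents (fun p ↦ Iso.refl _) fun {p q} k ↦ by
    change Z.map ((inl ι d).preimage ((inl ι d).map k)) ≫ 𝟙 _ = 𝟙 _ ≫ Z.map k
    rw [(inl ι d).preimage_map, Category.comp_id, Category.id_comp]

end ExtensionData

end Glue

end Glue

/-! ### Gluing weak factorization systems -/

namespace Glue

section

variable {P : Type w} [SmallCategory P] {C : Type w} [SmallCategory C] {D : Type w}
  {ι : P ⥤ C} {d : D → C} {M : Type u} [Category.{v} M]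

section Classes

variable (ι d)

/-- The maps whose restriction to `P` belongs to `LP` and whose relative latching maps at the
objects of `D` belong to `L`. -/
def gluedLeft [HasColimitsOfSize.{w, w} M] [HasPushouts M] (LP : MorphismProperty (P ⥤ M))
    (L : MorphismProperty M) : MorphismProperty (Glue ι d ⥤ M) :=
  fun _ _ f ↦ LP (Functor.whiskerLeft (inl ι d) f) ∧ ∀ x, L (relLatch (inl ι d) f (top x))

/-- The maps whose restriction to `P` belongs to `RP` and whose relative matching maps at the
objects of `D` belong to `R`. -/
def gluedRight [HasLimitsOfSize.{w, w} M] [HasPullbacks M] (RP : MorphismProperty (P ⥤ M))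
    (R : MorphismProperty M) : MorphismProperty (Glue ι d ⥤ M) :=
  fun _ _ f ↦ RP (Functor.whiskerLeft (inl ι d) f) ∧ ∀ x, R (relMatch (inl ι d) f (top x))

end Classes

section Latch

variable [HasColimitsOfSize.{w, w} M] [HasPushouts M] {X : Glue ι d ⥤ M} {Z : P ⥤ M}
  (a : inl ι d ⋙ X ⟶ Z) (x : D)

/-- The target `L_x Z ⊔_{L_x X} X_x` of the relative latching map. -/
noncomputable abbrev latchPushout : M :=
  pushout (latchMap a (top x)) (latchTo (inl ι d) X (top x))

/-- The maps `Z_p ⟶ L_x Z ⊔_{L_x X} X_x`. -/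
noncomputable def latchPushoutFamily : LatchFamily (inl ι d) Z (top x) (latchPushout a x) :=
  (latchInj (inl ι d) Z (top x)).postcomp (pushout.inl _ _)

variable {a x}

lemma map_comp_inr_latchPushout (p : P) (g : (inl ι d).obj p ⟶ top x) :
    X.map g ≫ pushout.inr (latchMap a (top x)) (latchTo (inl ι d) X (top x)) =
      a.app p ≫ (latchPushoutFamily a x).app p g := by
  rw [← latchInj_latchTo, Category.assoc, ← pushout.condition, reassoc_of% latchInj_latchMap]
  rfl

lemma latchPushout_hom_ext {E : M} {k k' : latchPushout a x ⟶ E}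
    (h₁ : ∀ p g, (latchPushoutFamily a x).app p g ≫ k = (latchPushoutFamily a x).app p g ≫ k')
    (h₂ : pushout.inr _ _ ≫ k = pushout.inr _ _ ≫ k') : k = k' := by
  refine pushout.hom_ext ((latchInj_isUniversal _ _ _).hom_ext fun p g ↦ ?_) h₂
  simpa only [latchPushoutFamily, LatchFamily.postcomp_app, Category.assoc] using h₁ p g

lemma exists_latchPushout_desc {E : M} (φ : LatchFamily (inl ι d) Z (top x) E)
    (α : X.obj (top x) ⟶ E) (h : ∀ p g, X.map g ≫ α = a.app p ≫ φ.app p g) :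
    ∃ k : latchPushout a x ⟶ E, (∀ p g, (latchPushoutFamily a x).app p g ≫ k = φ.app p g) ∧
      pushout.inr _ _ ≫ k = α := by
  refine ⟨pushout.desc ((latchInj_isUniversal _ _ _).desc φ) α
    ((latchInj_isUniversal _ _ _).hom_ext fun p g ↦ ?_), fun p g ↦ ?_, pushout.inr_desc _ _ _⟩
  · rw [reassoc_of% latchInj_latchMap, LatchFamily.IsUniversal.fac,
      reassoc_of% latchInj_latchTo, h]
  · rw [latchPushoutFamily, LatchFamily.postcomp_app, Category.assoc, pushout.inl_desc,
      LatchFamily.IsUniversal.fac]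

end Latch

section Match

variable [HasLimitsOfSize.{w, w} M] [HasPullbacks M] {Y : Glue ι d ⥤ M} {Z : P ⥤ M}
  (b : Z ⟶ inl ι d ⋙ Y) (x : D)

/-- The source `M_x Z ×_{M_x Y} Y_x` of the relative matching map. -/
noncomputable abbrev matchPullback : M :=
  pullback (matchMap b (top x)) (toMatch (inl ι d) Y (top x))

/-- The maps `M_x Z ×_{M_x Y} Y_x ⟶ Z_p`. -/
noncomputable def matchPullbackFamily : MatchFamily (inl ι d) Z (top x) (matchPullback b x) :=
  (matchProj (inl ι d) Z (top x)).precomp (pullback.fst _ _)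

variable {b x}

lemma snd_matchPullback_comp_map (p : P) (g : top x ⟶ (inl ι d).obj p) :
    pullback.snd (matchMap b (top x)) (toMatch (inl ι d) Y (top x)) ≫ Y.map g =
      (matchPullbackFamily b x).app p g ≫ b.app p := by
  rw [← toMatch_matchProj, ← pullback.condition_assoc, matchMap_matchProj]
  exact (Category.assoc _ _ _).symm

lemma matchPullback_hom_ext {A : M} {k k' : A ⟶ matchPullback b x}
    (h₁ : ∀ p g, k ≫ (matchPullbackFamily b x).app p g = k' ≫ (matchPullbackFamily b x).app p g)
    (h₂ : k ≫ pullback.snd _ _ = k' ≫ pullback.snd _ _) : k = k' := by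
  refine pullback.hom_ext ((matchProj_isUniversal _ _ _).hom_ext fun p g ↦ ?_) h₂
  simpa only [matchPullbackFamily, MatchFamily.precomp_app, Category.assoc] using h₁ p g

lemma exists_matchPullback_lift {A : M} (φ : MatchFamily (inl ι d) Z (top x) A)
    (α : A ⟶ Y.obj (top x)) (h : ∀ p g, α ≫ Y.map g = φ.app p g ≫ b.app p) :
    ∃ k : A ⟶ matchPullback b x, (∀ p g, k ≫ (matchPullbackFamily b x).app p g = φ.app p g) ∧
      k ≫ pullback.snd _ _ = α := by
  refine ⟨pullback.lift ((matchProj_isUniversal _ _ _).lift φ) α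
    ((matchProj_isUniversal _ _ _).hom_ext fun p g ↦ ?_), fun p g ↦ ?_, pullback.lift_snd _ _ _⟩
  · rw [Category.assoc, matchMap_matchProj, reassoc_of% MatchFamily.IsUniversal.fac,
      Category.assoc, toMatch_matchProj, h]
  · rw [matchPullbackFamily, MatchFamily.precomp_app, pullback.lift_fst_assoc,
      MatchFamily.IsUniversal.fac]

end Match

section Factorization

variable [ι.Full] [ι.Faithful] [HasColimitsOfSize.{w, w} M] [HasPushouts M]
  [HasLimitsOfSize.{w, w} M] [HasPullbacks M] {X Y : Glue ι d ⥤ M}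

/-- The map from the latching pushout to the matching pullback whose factorizations give the
factorizations of `f` extending a given one of its restriction to `P`. -/
lemma exists_latchPushout_to_matchPullback {Z : P ⥤ M} {a : inl ι d ⋙ X ⟶ Z}
    {b : Z ⟶ inl ι d ⋙ Y} (f : X ⟶ Y)
    (hf : a ≫ b = Functor.whiskerLeft (inl ι d) f) (x : D) :
    ∃ c : latchPushout a x ⟶ matchPullback b x,
      (∀ p q (g : (inl ι d).obj p ⟶ top x) (h : top x ⟶ (inl ι d).obj q),
        (latchPushoutFamily a x).app p g ≫ c ≫ (matchPullbackFamily b x).app q h =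
          Z.map ((inl ι d).preimage (g ≫ h))) ∧
      (∀ p g, (latchPushoutFamily a x).app p g ≫ c ≫ pullback.snd _ _ = b.app p ≫ Y.map g) ∧
      (∀ q h, pushout.inr _ _ ≫ c ≫ (matchPullbackFamily b x).app q h = X.map h ≫ a.app q) ∧
      pushout.inr _ _ ≫ c ≫ pullback.snd _ _ = f.app (top x) := by
  have hf' : ∀ p, a.app p ≫ b.app p = f.app ((inl ι d).obj p) := fun p ↦ congr_app hf p
  have ha : ∀ {p q} (e : (inl ι d).obj p ⟶ (inl ι d).obj q),
      X.map e ≫ a.app q = a.app p ≫ Z.map ((inl ι d).preimage e) := by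
    intro p q e
    obtain ⟨e, rfl⟩ := (inl ι d).map_surjective e
    rw [(inl ι d).preimage_map]
    exact a.naturality e
  have hb : ∀ {p q} (e : (inl ι d).obj p ⟶ (inl ι d).obj q),
      b.app p ≫ Y.map e = Z.map ((inl ι d).preimage e) ≫ b.app q := by
    intro p q e
    obtain ⟨e, rfl⟩ := (inl ι d).map_surjective e
    rw [(inl ι d).preimage_map]
    exact (b.naturality e).symm
  have hpre : ∀ {p q r} (e : (inl ι d).obj p ⟶ (inl ι d).obj q) (k : q ⟶ r),
      Z.map ((inl ι d).preimage e) ≫ Z.map k =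
        Z.map ((inl ι d).preimage (e ≫ (inl ι d).map k)) := by
    intro p q r e k
    rw [← Z.map_comp]
    exact congrArg Z.map ((inl ι d).map_injective (by simp))
  have hpre' : ∀ {p q r} (k : p ⟶ q) (e : (inl ι d).obj q ⟶ (inl ι d).obj r),
      Z.map k ≫ Z.map ((inl ι d).preimage e) =
        Z.map ((inl ι d).preimage ((inl ι d).map k ≫ e)) := by
    intro p q r k e
    rw [← Z.map_comp]
    exact congrArg Z.map ((inl ι d).map_injective (by simp))
  have h₁ : ∀ p (g : (inl ι d).obj p ⟶ top x), ∃ k : Z.obj p ⟶ matchPullback b x,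
      (∀ q h, k ≫ (matchPullbackFamily b x).app q h = Z.map ((inl ι d).preimage (g ≫ h))) ∧
      k ≫ pullback.snd _ _ = b.app p ≫ Y.map g := fun p g ↦
    exists_matchPullback_lift
      ⟨fun q h ↦ Z.map ((inl ι d).preimage (g ≫ h)), fun k h ↦ by
        rw [hpre, Category.assoc]⟩ (b.app p ≫ Y.map g) fun q h ↦ by
      rw [Category.assoc, ← Y.map_comp, hb]
  choose k hk₁ hk₂ using h₁
  obtain ⟨l, hl₁, hl₂⟩ := exists_matchPullback_lift (b := b) (x := x)
    ((MatchFamily.ofFunctor (inl ι d) X (top x)).postcomp a) (f.app (top x)) fun q h ↦ by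
      rw [MatchFamily.postcomp_app, Category.assoc, hf', MatchFamily.ofFunctor_app, f.naturality]
  obtain ⟨c, hc₁, hc₂⟩ := exists_latchPushout_desc (a := a) (x := x)
    ⟨k, fun {p q} e g ↦ matchPullback_hom_ext
      (fun r h ↦ by rw [Category.assoc, hk₁, hk₁, hpre', Category.assoc])
      (by
        rw [Category.assoc, hk₂, hk₂, Y.map_comp]
        exact b.naturality_assoc _ _)⟩ l fun p g ↦ matchPullback_hom_ext
      (fun r h ↦ by
        rw [Category.assoc, Category.assoc, hl₁, hk₁, MatchFamily.postcomp_app,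
          MatchFamily.ofFunctor_app, ← X.map_comp_assoc, ha])
      (by rw [Category.assoc, Category.assoc, hl₂, hk₂, reassoc_of% hf', f.naturality])
  refine ⟨c, fun p q g h ↦ ?_, fun p g ↦ ?_, fun q h ↦ ?_, ?_⟩
  · rw [reassoc_of% (hc₁ p g), hk₁]
  · rw [reassoc_of% (hc₁ p g), hk₂]
  · rw [reassoc_of% hc₂, hl₁, MatchFamily.postcomp_app, MatchFamily.ofFunctor_app]
  · rw [reassoc_of% hc₂, hl₂]

/-- Factorizations of maps from the latching pushouts to the matching pullbacks are the values at
the objects of `D` of an extension of `Z`. -/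
lemma exists_extension_of_factorization (hR : IsReedyLike ι d) {Z : P ⥤ M}
    {a : inl ι d ⋙ X ⟶ Z} {b : Z ⟶ inl ι d ⋙ Y}
    {c : ∀ x : D, latchPushout a x ⟶ matchPullback b x}
    (hc : ∀ x p q (g : (inl ι d).obj p ⟶ top x) (h : top x ⟶ (inl ι d).obj q),
        (latchPushoutFamily a x).app p g ≫ c x ≫ (matchPullbackFamily b x).app q h =
          Z.map ((inl ι d).preimage (g ≫ h)))
    {L R : MorphismProperty M} (F : ∀ x, L.MapFactorizationData R (c x)) :
    ∃ (W : Glue ι d ⥤ M) (e : inl ι d ⋙ W ≅ Z) (t : ∀ x, (F x).Z ≅ W.obj (top x)),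
      (∀ x p (g : (inl ι d).obj p ⟶ top x),
        (latchPushoutFamily a x).app p g ≫ (F x).i ≫ (t x).hom = e.inv.app p ≫ W.map g) ∧
      (∀ x p (g : top x ⟶ (inl ι d).obj p),
        (t x).inv ≫ (F x).p ≫ (matchPullbackFamily b x).app p g = W.map g ≫ e.hom.app p) := by
  let E : ExtensionData ι d Z :=
    { obj := fun x ↦ (F x).Z
      fromLow := fun x ↦ (latchPushoutFamily a x).postcomp (F x).i
      toLow := fun x ↦ (matchPullbackFamily b x).precomp (F x).p
      fac := fun x p q g h ↦ by
        rw [LatchFamily.postcomp_app, MatchFamily.precomp_app, Category.assoc,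
          (F x).fac_assoc, hc] }
  refine ⟨E.functor hR, E.restrictIso hR, fun x ↦ Iso.refl _, fun x p g ↦ ?_, fun x p g ↦ ?_⟩
  · exact (congrArg _ (Category.comp_id _)).trans (Category.id_comp (X := Z.obj p) _).symm
  · exact (Category.id_comp _).trans (Category.comp_id (Y := Z.obj p) _).symm

/-- A factorization of the restriction of `f` to `P` and factorizations of the maps from the
latching pushouts to the matching pullbacks glue to a factorization of `f`. -/
lemma exists_gluedFactorization (hR : IsReedyLike ι d)
    {LP RP : MorphismProperty (P ⥤ M)} {L R : MorphismProperty M}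
    [MorphismProperty.IsWeakFactorizationSystem LP RP]
    [MorphismProperty.IsWeakFactorizationSystem L R] (f : X ⟶ Y) :
    ∃ (W : Glue ι d ⥤ M) (i : X ⟶ W) (p : W ⟶ Y), i ≫ p = f ∧
      gluedLeft ι d LP L i ∧ gluedRight ι d RP R p := by
  obtain ⟨Z, a, b, hab, ha, hb⟩ :=
    MorphismProperty.factorizationData LP RP (Functor.whiskerLeft (inl ι d) f)
  choose c hc₁ hc₂ hc₃ hc₄ using exists_latchPushout_to_matchPullback f hab
  let F := fun x ↦ MorphismProperty.factorizationData L R (c x)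
  obtain ⟨W, e, t, hU, hV⟩ := exists_extension_of_factorization hR hc₁ F
  have hU' : ∀ x p (g : (inl ι d).obj p ⟶ top x),
      W.map g = e.hom.app p ≫ (latchPushoutFamily a x).app p g ≫ (F x).i ≫ (t x).hom := by
    intro x p g
    rw [hU, Iso.hom_inv_id_app_assoc]
  have hV' : ∀ x p (g : top x ⟶ (inl ι d).obj p),
      W.map g = (t x).inv ≫ (F x).p ≫ (matchPullbackFamily b x).app p g ≫ e.inv.app p := by
    intro x p g
    rw [← Category.assoc (F x).p, ← Category.assoc (t x).inv, hV, Category.assoc,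
      Iso.hom_inv_id_app]
    exact (Category.comp_id _).symm
  let i : X ⟶ W := natTransMk hR (a ≫ e.inv) (fun x ↦ pushout.inr _ _ ≫ (F x).i ≫ (t x).hom)
    (fun p x g ↦ by
      rw [← Category.assoc, map_comp_inr_latchPushout, Category.assoc, hU, NatTrans.comp_app,
        Category.assoc])
    (fun p x g ↦ by
      rw [hV', Category.assoc, Category.assoc, Iso.hom_inv_id_assoc, (F x).fac_assoc,
        reassoc_of% hc₃, NatTrans.comp_app])
  let p : W ⟶ Y := natTransMk hR (e.hom ≫ b) (fun x ↦ (t x).inv ≫ (F x).p ≫ pullback.snd _ _)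
    (fun p x g ↦ by
      rw [hU', Category.assoc, Category.assoc, Category.assoc, Iso.hom_inv_id_assoc,
        (F x).fac_assoc, hc₂, NatTrans.comp_app, Category.assoc])
    (fun p x g ↦ by
      rw [Category.assoc, Category.assoc, snd_matchPullback_comp_map, NatTrans.comp_app,
        reassoc_of% hV])
  have hi : ∀ x, i.app (top x) = pushout.inr _ _ ≫ (F x).i ≫ (t x).hom := fun x ↦ rfl
  have hp : ∀ x, p.app (top x) = (t x).inv ≫ (F x).p ≫ pullback.snd _ _ := fun x ↦ rfl
  have hi' : ∀ q, i.app ((inl ι d).obj q) = a.app q ≫ e.inv.app q := fun q ↦ rfl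
  have hp' : ∀ q, p.app ((inl ι d).obj q) = e.hom.app q ≫ b.app q := fun q ↦ rfl
  refine ⟨W, i, p, ?_, ⟨?_, fun x ↦ ?_⟩, ⟨?_, fun x ↦ ?_⟩⟩
  · ext (q | x)
    · refine Eq.trans ?_ (congr_app hab q)
      change (a.app q ≫ e.inv.app q) ≫ e.hom.app q ≫ b.app q = _
      simp
    · rw [NatTrans.comp_app, hi, hp, Category.assoc, Category.assoc, Iso.hom_inv_id_assoc,
        (F x).fac_assoc, hc₄]
  · rw [← MorphismProperty.llp_eq_of_wfs LP RP] at ha ⊢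
    exact (MorphismProperty.cancel_right_of_respectsIso RP.llp a e.inv).2 ha
  · rw [← MorphismProperty.llp_eq_of_wfs L R]
    intro A B q hq
    rw [hasLiftingProperty_relLatch_iff]
    intro φ α β h₁ h₂ h₃
    obtain ⟨k, hk₁, hk₂⟩ := exists_latchPushout_desc (a := a) (x := x)
      (φ.precomp e.inv) α fun q g ↦ by
        rw [← h₁, hi', Category.assoc, LatchFamily.precomp_app]
    have := MorphismProperty.hasLiftingProperty_of_wfs (F x).i q (F x).hi hq
    have sq : CommSq k (F x).i q ((t x).hom ≫ β) := by
      refine ⟨latchPushout_hom_ext (fun s g ↦ ?_) ?_⟩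
      · rw [reassoc_of% (hk₁ s g), LatchFamily.precomp_app, Category.assoc, h₃,
          ← reassoc_of% hU]
      · rw [reassoc_of% hk₂, h₂, hi, Category.assoc, Category.assoc]
    refine ⟨(t x).inv ≫ sq.lift, fun s g ↦ ?_, ?_, ?_⟩
    · rw [hU', Category.assoc, Category.assoc, Category.assoc, Iso.hom_inv_id_assoc, sq.fac_left,
        hk₁, LatchFamily.precomp_app, Iso.hom_inv_id_app_assoc]
    · rw [hi, Category.assoc, Category.assoc, Iso.hom_inv_id_assoc, sq.fac_left, hk₂]
    · rw [Category.assoc, sq.fac_right, Iso.inv_hom_id_assoc]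
  · rw [← MorphismProperty.rlp_eq_of_wfs LP RP] at hb ⊢
    exact (MorphismProperty.cancel_left_of_respectsIso LP.rlp e.hom b).2 hb
  · rw [← MorphismProperty.rlp_eq_of_wfs L R]
    intro A B j hj
    rw [hasLiftingProperty_relMatch_iff]
    intro φ α β h₁ h₂ h₃
    obtain ⟨k, hk₁, hk₂⟩ := exists_matchPullback_lift (b := b) (x := x)
      (φ.postcomp e.hom) α fun q g ↦ by
        rw [← h₁, hp', MatchFamily.postcomp_app, Category.assoc]
    have := MorphismProperty.hasLiftingProperty_of_wfs j (F x).p hj (F x).hp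
    have sq : CommSq (β ≫ (t x).inv) j (F x).p k := by
      refine ⟨matchPullback_hom_ext (fun s g ↦ ?_) ?_⟩
      · rw [Category.assoc, Category.assoc, Category.assoc, hk₁, MatchFamily.postcomp_app,
          reassoc_of% h₃, hV]
      · rw [Category.assoc, Category.assoc, Category.assoc, hk₂, ← h₂, hp]
    refine ⟨sq.lift ≫ (t x).hom, fun s g ↦ ?_, ?_, ?_⟩
    · rw [hV', Category.assoc, Iso.hom_inv_id_assoc, sq.fac_right_assoc, reassoc_of% hk₁,
        MatchFamily.postcomp_app, Category.assoc, Iso.hom_inv_id_app]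
      exact Category.comp_id _
    · rw [hp, Category.assoc, Iso.hom_inv_id_assoc, sq.fac_right_assoc, hk₂]
    · rw [sq.fac_left_assoc, Category.assoc, Iso.inv_hom_id, Category.comp_id]

omit [ι.Faithful] in
/-- A lift of the restrictions to `P` extends to `Glue ι d`: at `x : D` one has to lift the relative
latching map of `i` against the relative matching map of `p`. -/
lemma hasLiftingProperty_of_glued (hR : IsReedyLike ι d)
    {LP RP : MorphismProperty (P ⥤ M)} {L R : MorphismProperty M}
    [MorphismProperty.IsWeakFactorizationSystem LP RP]
    [MorphismProperty.IsWeakFactorizationSystem L R] {A B : Glue ι d ⥤ M} (i : A ⟶ B)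
    (p : X ⟶ Y) (hi : gluedLeft ι d LP L i) (hp : gluedRight ι d RP R p) :
    HasLiftingProperty i p := by
  refine ⟨fun {α β} sq ↦ ?_⟩
  have hw : ∀ q, α.app q ≫ p.app q = i.app q ≫ β.app q := fun q ↦ congr_app sq.w q
  have := MorphismProperty.hasLiftingProperty_of_wfs _ _ hi.1 hp.1
  have sqP : CommSq (Functor.whiskerLeft (inl ι d) α) (Functor.whiskerLeft (inl ι d) i)
      (Functor.whiskerLeft (inl ι d) p) (Functor.whiskerLeft (inl ι d) β) :=
    ⟨by rw [← Functor.whiskerLeft_comp, ← Functor.whiskerLeft_comp, sq.w]⟩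
  let τ : inl ι d ⋙ B ⟶ inl ι d ⋙ X := sqP.lift
  have hτ₁ : ∀ s, i.app ((inl ι d).obj s) ≫ τ.app s = α.app _ :=
    fun s ↦ congr_app sqP.fac_left s
  have hτ₂ : ∀ s, τ.app s ≫ p.app ((inl ι d).obj s) = β.app _ :=
    fun s ↦ congr_app sqP.fac_right s
  have key : ∀ x, ∃ l : B.obj (top x) ⟶ X.obj (top x),
      (∀ s (g : (inl ι d).obj s ⟶ top x), B.map g ≫ l = τ.app s ≫ X.map g) ∧
      (∀ s (g : top x ⟶ (inl ι d).obj s), B.map g ≫ τ.app s = l ≫ X.map g) ∧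
      i.app _ ≫ l = α.app _ ∧ l ≫ p.app _ = β.app _ := by
    intro x
    obtain ⟨m, hm₁, hm₂⟩ := exists_matchPullback_lift
      (b := Functor.whiskerLeft (inl ι d) p) (x := x)
      ((MatchFamily.ofFunctor (inl ι d) B (top x)).postcomp τ) (β.app (top x)) fun s g ↦ by
        rw [MatchFamily.postcomp_app, MatchFamily.ofFunctor_app, Category.assoc,
          Functor.whiskerLeft_app, hτ₂, β.naturality]
    have hrel : ∀ s g, relMatch (inl ι d) p (top x) ≫
        (matchPullbackFamily (Functor.whiskerLeft (inl ι d) p) x).app s g = X.map g := by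
      intro s g
      rw [matchPullbackFamily, MatchFamily.precomp_app, relMatch, pullback.lift_fst_assoc,
        toMatch_matchProj]
    have hrel' : relMatch (inl ι d) p (top x) ≫ pullback.snd _ _ = p.app (top x) :=
      pullback.lift_snd _ _ _
    have := MorphismProperty.hasLiftingProperty_of_wfs _ _ (hi.2 x) (hp.2 x)
    rw [hasLiftingProperty_relLatch_iff] at this
    obtain ⟨l, hl₁, hl₂, hl₃⟩ := this
      ((LatchFamily.ofFunctor (inl ι d) X (top x)).precomp τ) (α.app (top x)) m
      (fun s g ↦ by
        rw [LatchFamily.precomp_app, reassoc_of% hτ₁, LatchFamily.ofFunctor_app, α.naturality])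
      (matchPullback_hom_ext
        (fun s g ↦ by
          rw [Category.assoc, Category.assoc, hm₁, hrel, MatchFamily.postcomp_app,
            MatchFamily.ofFunctor_app, ← i.naturality_assoc, ← α.naturality, hτ₁])
        (by rw [Category.assoc, Category.assoc, hm₂, hrel', hw]))
      (fun s g ↦ matchPullback_hom_ext
        (fun t h ↦ by
          rw [Category.assoc, Category.assoc, hm₁, hrel, MatchFamily.postcomp_app,
            MatchFamily.ofFunctor_app, LatchFamily.precomp_app, LatchFamily.ofFunctor_app,
            Category.assoc, ← X.map_comp, ← B.map_comp_assoc]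
          obtain ⟨e, he⟩ := (inl ι d).map_surjective (g ≫ h)
          rw [← he]
          exact (τ.naturality e).symm)
        (by
          rw [Category.assoc, Category.assoc, hm₂, hrel', LatchFamily.precomp_app,
            LatchFamily.ofFunctor_app, Category.assoc, p.naturality, reassoc_of% hτ₂,
            β.naturality]))
    refine ⟨l, hl₁, fun s g ↦ ?_, hl₂, ?_⟩
    · rw [← hrel, reassoc_of% hl₃, hm₁, MatchFamily.postcomp_app, MatchFamily.ofFunctor_app]
    · rw [← hrel', reassoc_of% hl₃, hm₂]
  choose l hl₁ hl₂ hl₃ hl₄ using key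
  refine ⟨⟨⟨natTransMk hR τ l (fun s x g ↦ hl₁ x s g) (fun s x g ↦ hl₂ x s g), ?_, ?_⟩⟩⟩
  · ext (s | x)
    · exact hτ₁ s
    · exact hl₃ x
  · ext (s | x)
    · exact hτ₂ s
    · exact hl₄ x

variable (ι d) in
/-- Weak factorization systems on `P ⥤ M` and on `M` glue. -/
theorem isWeakFactorizationSystem_glued (hR : IsReedyLike ι d)
    (LP RP : MorphismProperty (P ⥤ M)) (L R : MorphismProperty M)
    [MorphismProperty.IsWeakFactorizationSystem LP RP]
    [MorphismProperty.IsWeakFactorizationSystem L R] :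
    MorphismProperty.IsWeakFactorizationSystem (gluedLeft ι d LP L) (gluedRight ι d RP R) := by
  have : MorphismProperty.HasFactorization (gluedLeft ι d LP L) (gluedRight ι d RP R) :=
    ⟨fun f ↦ by
      obtain ⟨W, i, p, fac, hi, hp⟩ :=
        exists_gluedFactorization hR (LP := LP) (RP := RP) (L := L) (R := R) f
      exact ⟨⟨W, i, p, fac, hi, hp⟩⟩⟩
  have : (gluedLeft ι d LP L).IsStableUnderRetracts := ⟨fun {X Y X' Y' f f'} h hf ↦ by
    refine ⟨?_, fun x ↦ ?_⟩
    · have hf₁ := hf.1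
      rw [← MorphismProperty.llp_eq_of_wfs LP RP] at hf₁ ⊢
      exact MorphismProperty.of_retract
        (h.map ((Functor.whiskeringLeft _ _ M).obj (inl ι d))) hf₁
    · have hf₂ := hf.2 x
      rw [← MorphismProperty.llp_eq_of_wfs L R] at hf₂ ⊢
      intro E B p hp
      exact (hasLiftingProperty_relLatch_iff _ _ _ p).2
        (((hasLiftingProperty_relLatch_iff _ _ _ p).1 (hf₂ p hp)).of_retract h)⟩
  have : (gluedRight ι d RP R).IsStableUnderRetracts := ⟨fun {X Y X' Y' f f'} h hf ↦ by
    refine ⟨?_, fun x ↦ ?_⟩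
    · have hf₁ := hf.1
      rw [← MorphismProperty.rlp_eq_of_wfs LP RP] at hf₁ ⊢
      exact MorphismProperty.of_retract
        (h.map ((Functor.whiskeringLeft _ _ M).obj (inl ι d))) hf₁
    · have hf₂ := hf.2 x
      rw [← MorphismProperty.rlp_eq_of_wfs L R] at hf₂ ⊢
      intro A B i hi
      exact (hasLiftingProperty_relMatch_iff _ _ _ i).2
        (((hasLiftingProperty_relMatch_iff _ _ _ i).1 (hf₂ i hi)).of_retract h)⟩
  exact .mk' _ _ fun i p hi hp ↦ hasLiftingProperty_of_glued hR i p hi hp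

end Factorization

end

end Glue

/-! ### Factorizations in Reedy categories -/

section Zigzag

variable {R : Type w} [SmallCategory R] {Rm Rp : MorphismProperty R}
  [Rm.IsMultiplicative] [Rp.IsMultiplicative] (S : ReedyStructure Rm Rp Ordinal.{t})

/-- Every factorization of `f` is connected to the Reedy factorization by a zigzag of factorizations
which does not increase the degree of the middle object. -/
lemma exists_zigzag {r s : R} (f : r ⟶ s) :
    ∃ (z : R) (g₀ : r ⟶ z) (h₀ : z ⟶ s), ∀ (t : R) (g : r ⟶ t) (h : t ⟶ s), g ≫ h = f →
      S.deg z ≤ S.deg t ∧ ∃ (t₁ : R) (g₁ : r ⟶ t₁) (a : t₁ ⟶ t) (b : t₁ ⟶ z),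
        S.deg t₁ ≤ S.deg t ∧ g₁ ≫ a = g ∧ g₁ ≫ b = g₀ ∧ a ≫ h = b ≫ h₀ := by
  refine ⟨_, (S.mapFactorizationData f).i, (S.mapFactorizationData f).p, fun t g h hf ↦ ?_⟩
  obtain ⟨t₁, g₁, a, hg₁, ha, rfl, -⟩ := S.exists_fac g
  obtain ⟨t₂, b, q, hb, hq, hbq, -⟩ := S.exists_fac (a ≫ h)
  have : S.mapFactorizationData f = ⟨t₂, g₁ ≫ b, q, by rw [Category.assoc, hbq, ← hf,
      Category.assoc], Rm.comp_mem _ _ hg₁ hb, hq⟩ :=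
    (S.subsingleton_mapFactorizationData f).elim _ _
  rw [this]
  exact ⟨(S.le₁ b hb).trans (S.le₂ a ha), t₁, g₁, a, b, S.le₂ a ha, rfl, rfl, hbq.symm⟩

/-- The variant of `exists_zigzag` where the zigzags point in the opposite direction. -/
lemma exists_zigzag' {r s : R} (f : r ⟶ s) :
    ∃ (z : R) (g₀ : r ⟶ z) (h₀ : z ⟶ s), ∀ (t : R) (g : r ⟶ t) (h : t ⟶ s), g ≫ h = f →
      S.deg z ≤ S.deg t ∧ ∃ (t₁ : R) (h₁ : t₁ ⟶ s) (a : t ⟶ t₁) (b : z ⟶ t₁),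
        S.deg t₁ ≤ S.deg t ∧ a ≫ h₁ = h ∧ b ≫ h₁ = h₀ ∧ g ≫ a = g₀ ≫ b := by
  refine ⟨_, (S.mapFactorizationData f).i, (S.mapFactorizationData f).p, fun t g h hf ↦ ?_⟩
  obtain ⟨t₁, a, h₁, ha, hh₁, rfl, -⟩ := S.exists_fac h
  obtain ⟨t₂, q, b, hq, hb, hbq, -⟩ := S.exists_fac (g ≫ a)
  have : S.mapFactorizationData f = ⟨t₂, q, b ≫ h₁, by rw [reassoc_of% hbq, hf],
      hq, Rp.comp_mem _ _ hb hh₁⟩ :=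
    (S.subsingleton_mapFactorizationData f).elim _ _
  rw [this]
  exact ⟨(S.le₂ b hb).trans (S.le₁ a ha), t₁, h₁, a, b, S.le₁ a ha, rfl, rfl, hbq.symm⟩

/-- The objects of degree exactly `μ`. -/
abbrev DegEq (μ : Ordinal.{t}) : Type w := { r : R // S.deg r = μ }

/-- The objects of degree at most `μ`, as those of degree less than `μ` and those of degree `μ`. -/
abbrev Stage (μ : Ordinal.{t}) : Type w := Glue (incl S μ) (Subtype.val : DegEq S μ → R)

lemma isReedyLike_stage (μ : Ordinal.{t}) :
    Glue.IsReedyLike (incl S μ) (Subtype.val : DegEq S μ → R) where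
  eq_or_fac := by
    rintro ⟨x, hx⟩ ⟨y, hy⟩ ⟨f⟩
    obtain ⟨z, a, b, ha, hb, rfl, -⟩ := S.exists_fac (f : x ⟶ y)
    rcases ((S.le₁ a ha).trans_eq hx).lt_or_eq with hz | hz
    · exact Or.inr ⟨⟨z, hz⟩, Glue.homMk a, Glue.homMk b, rfl⟩
    · obtain ⟨_⟩ := S.identities_of_prop₁_of_eq ha (hx.trans hz.symm)
      obtain ⟨_⟩ := S.identities_of_prop₂_of_eq hb (hz.trans hy.symm)
      exact Or.inl ⟨rfl, InducedCategory.hom_ext (Category.comp_id _)⟩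
  comp_ne_id {x p} g h H := by
    have h₁ : g.hom ≫ h.hom = 𝟙 x.1 := congrArg InducedCategory.Hom.hom H
    have h₂ := S.degHom_le g.hom h.hom
    rw [h₁, S.degHom_id, x.2] at h₂
    exact h₂.not_gt p.property
  zigzag {x y p} g h := by
    obtain ⟨z, g₀, h₀, H⟩ := exists_zigzag S ((g ≫ h).hom)
    refine ⟨⟨z, (H p.obj g.hom h.hom rfl).1.trans_lt p.property⟩, Glue.homMk g₀, Glue.homMk h₀,
      fun p' g' h' w ↦ ?_⟩
    obtain ⟨-, t₁, g₁, a, b, ht₁, e₁, e₂, e₃⟩ :=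
      H p'.obj g'.hom h'.hom (congrArg InducedCategory.Hom.hom w)
    exact ⟨⟨t₁, ht₁.trans_lt p'.property⟩, Glue.homMk g₁, ObjectProperty.homMk a,
      ObjectProperty.homMk b, InducedCategory.hom_ext e₁, InducedCategory.hom_ext e₂,
      InducedCategory.hom_ext e₃⟩

end Zigzag

/-! ### The coends and ends defining latching and matching objects -/

section Coend

variable {R : Type w} [SmallCategory R] {Rm Rp : MorphismProperty R}
  [Rm.IsMultiplicative] [Rp.IsMultiplicative] (S : ReedyStructure Rm Rp Ordinal.{t})
  {M : Type u} [Category.{v} M]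

section

variable [HasColimitsOfSize.{w, w} M]

/-- The universal family on the coend `L_r X`. -/
noncomputable def latchingFamily (X : R ⥤ M) (r : R) :
    LatchFamily (incl S (S.deg r)) (incl S (S.deg r) ⋙ X) r (latchingObj S X r) where
  app s g := Sigma.ι (fun _ : s.obj ⟶ r ↦ X.obj s.obj) g ≫
    coend.ι (latchingBifunctor S X r) s
  naturality {s t} k g := by
    have := Sigma.ι (fun _ : t.obj ⟶ r ↦ X.obj s.obj) g ≫=
      coend.condition (latchingBifunctor S X r) k
    dsimp [latchingBifunctor] at this ⊢
    simp at this
    exact this.symm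

lemma latchingFamily_isUniversal (X : R ⥤ M) (r : R) : (latchingFamily S X r).IsUniversal := by
  intro E ψ
  refine ⟨coend.desc (F := latchingBifunctor S X r)
    (fun s ↦ Sigma.desc fun g : s.obj ⟶ r ↦ ψ.app s g) ?_, fun s g ↦ ?_, fun d hd ↦ ?_⟩
  · intro s t k
    dsimp [latchingBifunctor]
    apply Sigma.hom_ext
    intro g
    simpa using (ψ.naturality k g).symm
  · dsimp [latchingFamily]
    refine (Category.assoc _ _ _).trans ((congrArg _ (coend.ι_desc _ _ _)).trans ?_)
    exact Sigma.ι_desc _ _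
  · apply coend.hom_ext
    intro s
    refine Eq.trans ?_ (coend.ι_desc _ _ _).symm
    apply Sigma.hom_ext
    intro g
    refine Eq.trans ?_ (Sigma.ι_desc (fun g : s.obj ⟶ r ↦ ψ.app s g) g).symm
    refine Eq.trans ?_ (hd s g)
    exact (Category.assoc _ _ _).symm

lemma hasLiftingProperty_relLatchingMap_iff [HasPushouts M] {X Y : R ⥤ M} (f : X ⟶ Y) (r : R)
    {E B : M} (p : E ⟶ B) :
    HasLiftingProperty (relLatchingMap S f r) p ↔ LatchLift (incl S (S.deg r)) f r p := by
  refine hasLiftingProperty_pushoutDesc_iff f r (latchingFamily_isUniversal S X r)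
    (latchingFamily_isUniversal S Y r) (fun s g ↦ ?_) (fun s g ↦ ?_) (fun s g ↦ ?_) _ p
  · dsimp [latchingFamily]
    refine (Category.assoc _ _ _).trans ((congrArg _ (coend.ι_map _ _)).trans ?_)
    refine (Category.assoc _ _ _).symm.trans (Eq.trans ?_ (Category.assoc _ _ _))
    exact congrArg (· ≫ coend.ι (latchingBifunctor S Y r) s)
      (Sigma.ι_map (fun _ : s.obj ⟶ r ↦ f.app s.obj) g)
  · dsimp [latchingFamily]
    refine (Category.assoc _ _ _).trans ((congrArg _ (coend.ι_desc _ _ _)).trans ?_)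
    exact Sigma.ι_desc _ _
  · dsimp [latchingFamily]
    refine (Category.assoc _ _ _).trans ((congrArg _ (coend.ι_desc _ _ _)).trans ?_)
    exact Sigma.ι_desc _ _

end

section

variable [HasLimitsOfSize.{w, w} M]

/-- The universal family on the end `M_r X`. -/
noncomputable def matchingFamily (X : R ⥤ M) (r : R) :
    MatchFamily (incl S (S.deg r)) (incl S (S.deg r) ⋙ X) r (matchingObj S X r) where
  app s g := end_.π (matchingBifunctor S X r) s ≫
    Pi.π (fun _ : r ⟶ s.obj ↦ X.obj s.obj) g
  naturality {s t} k g := by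
    have := end_.condition (matchingBifunctor S X r) k =≫
      Pi.π (fun _ : r ⟶ s.obj ↦ X.obj t.obj) g
    dsimp [matchingBifunctor] at this ⊢
    simp at this
    exact (Category.assoc _ _ _).trans this

lemma matchingFamily_isUniversal (X : R ⥤ M) (r : R) : (matchingFamily S X r).IsUniversal := by
  intro A ψ
  refine ⟨end_.lift (F := matchingBifunctor S X r)
    (fun s ↦ Pi.lift fun g : r ⟶ s.obj ↦ ψ.app s g) ?_, fun s g ↦ ?_, fun d hd ↦ ?_⟩
  · intro s t k
    dsimp [matchingBifunctor]
    apply Pi.hom_ext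
    intro g
    simpa using ψ.naturality k g
  · dsimp [matchingFamily]
    refine (Category.assoc _ _ _).symm.trans ((congrArg (· ≫ _) (end_.lift_π _ _ _)).trans ?_)
    exact Pi.lift_π _ _
  · apply end_.hom_ext
    intro s
    refine Eq.trans ?_ (end_.lift_π _ _ _).symm
    apply Pi.hom_ext
    intro g
    refine Eq.trans ?_ (Pi.lift_π (fun g : r ⟶ s.obj ↦ ψ.app s g) g).symm
    refine Eq.trans ?_ (hd s g)
    exact Category.assoc _ _ _

lemma hasLiftingProperty_relMatchingMap_iff [HasPullbacks M] {X Y : R ⥤ M} (f : X ⟶ Y) (r : R)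
    {A B : M} (i : A ⟶ B) :
    HasLiftingProperty i (relMatchingMap S f r) ↔ MatchLift (incl S (S.deg r)) f r i := by
  refine hasLiftingProperty_pullbackLift_iff f r (matchingFamily_isUniversal S X r)
    (matchingFamily_isUniversal S Y r) (fun s g ↦ ?_) (fun s g ↦ ?_) (fun s g ↦ ?_) _ i
  · dsimp [matchingFamily]
    refine (Category.assoc _ _ _).symm.trans ((congrArg (· ≫ _) (end_.map_π _ _)).trans ?_)
    refine (Category.assoc _ _ _).trans (Eq.trans ?_ (Category.assoc _ _ _).symm)
    exact congrArg (end_.π (matchingBifunctor S X r) s ≫ ·)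
      (Pi.map_π (fun _ : r ⟶ s.obj ↦ f.app s.obj) g)
  · dsimp [matchingFamily]
    refine (Category.assoc _ _ _).symm.trans ((congrArg (· ≫ _) (end_.lift_π _ _ _)).trans ?_)
    exact Pi.lift_π _ _
  · dsimp [matchingFamily]
    refine (Category.assoc _ _ _).symm.trans ((congrArg (· ≫ _) (end_.lift_π _ _ _)).trans ?_)
    exact Pi.lift_π _ _

end

end Coend

/-! ### Free and cofree diagrams -/

section Free

variable {P₁ P Q : Type w} [SmallCategory P₁] [SmallCategory P] [SmallCategory Q] {M : Type u}
  [Category.{v} M]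

section

variable [HasColimitsOfSize.{w, w} M]

/-- For a functor `H` to types, the map of diagrams `H ⊙ A ⟶ H ⊙ B`, which consists of the
coproducts `∐_{H s} A ⟶ ∐_{H s} B`. -/
noncomputable def copowerMap (H : P ⥤ Type w) {A B : M} (i : A ⟶ B) :
    H ⋙ sigmaConst.{w}.obj A ⟶ H ⋙ sigmaConst.{w}.obj B :=
  Functor.whiskerLeft H (sigmaConst.{w}.map i)

/-- The relative latching map of `H ⊙ A ⟶ H ⊙ B` at `s` is a coproduct of copies of `A ⟶ B` and of
identities if the latching map of `H` at `s` is injective. The hypothesis expresses this injectivity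
by zigzags. -/
lemma latchLift_copowerMap (ι : P₁ ⥤ P) (H : P ⥤ Type w) (s : P)
    (hH : ∀ (t : P₁) (g : ι.obj t ⟶ s) (h : H.obj (ι.obj t)),
      ∃ (t₀ : P₁) (g₀ : ι.obj t₀ ⟶ s) (h₀ : H.obj (ι.obj t₀)),
        ∀ (t' : P₁) (g' : ι.obj t' ⟶ s) (h' : H.obj (ι.obj t')), H.map g' h' = H.map g h →
          ∃ (t₁ : P₁) (h₁ : H.obj (ι.obj t₁)) (a : t₁ ⟶ t') (b : t₁ ⟶ t₀),
            H.map (ι.map a) h₁ = h' ∧ H.map (ι.map b) h₁ = h₀ ∧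
              ι.map a ≫ g' = ι.map b ≫ g₀)
    {A B E F : M} (i : A ⟶ B) (p : E ⟶ F) [HasLiftingProperty i p] :
    LatchLift ι (copowerMap H i) s p := by
  intro φ α β h₁ h₂ h₃
  let ψ : ∀ (t : P₁) (_ : ι.obj t ⟶ s) (_ : H.obj (ι.obj t)), B ⟶ E := fun t g h ↦
    Sigma.ι (fun _ : H.obj (ι.obj t) ↦ B) h ≫ φ.app t g
  have hψ : ∀ {t t' : P₁} (a : t ⟶ t') (g : ι.obj t' ⟶ s) (h : H.obj (ι.obj t)),
      ψ t' g (H.map (ι.map a) h) = ψ t (ι.map a ≫ g) h := by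
    intro t t' a g h
    simp only [ψ]
    rw [← φ.naturality a g]
    dsimp
    simp
  -- by connectedness, `ψ` only depends on the image in `H s`
  have hψ' : ∀ (t t' : P₁) (g : ι.obj t ⟶ s) (g' : ι.obj t' ⟶ s) (h : H.obj (ι.obj t))
      (h' : H.obj (ι.obj t')), H.map g h = H.map g' h' → ψ t g h = ψ t' g' h' := by
    intro t t' g g' h h' w
    obtain ⟨t₀, g₀, h₀, K⟩ := hH t g h
    have key : ∀ (u : P₁) (k : ι.obj u ⟶ s) (l : H.obj (ι.obj u)), H.map k l = H.map g h →
        ψ u k l = ψ t₀ g₀ h₀ := by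
      intro u k l hkl
      obtain ⟨t₁, h₁, a, b, rfl, rfl, hab⟩ := K u k l hkl
      rw [hψ, hψ, hab]
    rw [key t g h rfl, key t' g' h' w.symm]
  have key : ∀ x : H.obj s, ∃ l : B ⟶ E,
      (∀ (t : P₁) (g : ι.obj t ⟶ s) (h : H.obj (ι.obj t)), H.map g h = x → ψ t g h = l) ∧
      i ≫ l = Sigma.ι (fun _ : H.obj s ↦ A) x ≫ α ∧
      l ≫ p = Sigma.ι (fun _ : H.obj s ↦ B) x ≫ β := by
    intro x
    by_cases hx : ∃ (t : P₁) (g : ι.obj t ⟶ s) (h : H.obj (ι.obj t)), H.map g h = x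
    · obtain ⟨t, g, h, rfl⟩ := hx
      refine ⟨ψ t g h, fun t' g' h' w ↦ hψ' _ _ _ _ _ _ w, ?_, ?_⟩
      · have := Sigma.ι (fun _ : H.obj (ι.obj t) ↦ A) h ≫= h₁ t g
        dsimp [copowerMap] at this
        simpa using! this
      · have := Sigma.ι (fun _ : H.obj (ι.obj t) ↦ B) h ≫= h₃ t g
        dsimp at this
        simpa [ψ] using! this
    · have sq : CommSq (Sigma.ι (fun _ : H.obj s ↦ A) x ≫ α) i p
          (Sigma.ι (fun _ : H.obj s ↦ B) x ≫ β) := by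
        constructor
        have := Sigma.ι (fun _ : H.obj s ↦ A) x ≫= h₂
        dsimp [copowerMap] at this
        simpa using! this
      exact ⟨sq.lift, fun t g h w ↦ (hx ⟨t, g, h, w⟩).elim, sq.fac_left, sq.fac_right⟩
  choose l hl₁ hl₂ hl₃ using key
  refine ⟨Limits.Sigma.desc l, fun t g ↦ ?_, ?_, ?_⟩
  · dsimp
    apply Sigma.hom_ext
    intro h
    simp
    exact (hl₁ _ t g h rfl).symm
  · dsimp [copowerMap]
    apply Sigma.hom_ext
    intro h
    simp
    exact hl₂ h
  · apply Sigma.hom_ext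
    intro h
    refine (Category.assoc _ _ _).symm.trans ?_
    refine (congrArg (· ≫ p) (Sigma.ι_desc l h)).trans (hl₃ h)

end

section

variable [HasLimitsOfSize.{w, w} M]

/-- If the copowers of the representable functor at `r` send `L` to `LP`, then the matching object
functor at `r` sends `RP` to `R`. -/
lemma matchMap_mem_of_wfs [HasColimitsOfSize.{w, w} M] (ι : P ⥤ Q) (r : Q)
    {LP RP : MorphismProperty (P ⥤ M)} {L R : MorphismProperty M}
    [MorphismProperty.IsWeakFactorizationSystem LP RP]
    [MorphismProperty.IsWeakFactorizationSystem L R]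
    (hL : ∀ {A B : M} (i : A ⟶ B), L i → LP (copowerMap (ι ⋙ coyoneda.obj (op r)) i))
    {Z Z' : P ⥤ M} (f : Z ⟶ Z') (hf : RP f) : R (matchMap (ι := ι) f r) := by
  rw [← MorphismProperty.rlp_eq_of_wfs L R]
  intro A B i hi
  have := MorphismProperty.hasLiftingProperty_of_wfs _ _ (hL i hi) hf
  refine ⟨fun {α β} sq ↦ ?_⟩
  have hw : ∀ s g, α ≫ (matchProj ι Z r).app s g ≫ f.app s =
      i ≫ β ≫ (matchProj ι Z' r).app s g := by
    intro s g
    rw [← matchMap_matchProj, sq.w_assoc]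
  let α' : (ι ⋙ coyoneda.obj (op r)) ⋙ sigmaConst.obj A ⟶ Z :=
    { app s := Limits.Sigma.desc fun g : r ⟶ ι.obj s ↦ α ≫ (matchProj ι Z r).app s g
      naturality s t k := by
        dsimp
        apply Sigma.hom_ext
        intro g
        simpa using α ≫= ((matchProj ι Z r).naturality k g).symm }
  let β' : (ι ⋙ coyoneda.obj (op r)) ⋙ sigmaConst.obj B ⟶ Z' :=
    { app s := Limits.Sigma.desc fun g : r ⟶ ι.obj s ↦ β ≫ (matchProj ι Z' r).app s g
      naturality s t k := by
        dsimp
        apply Sigma.hom_ext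
        intro g
        simpa using β ≫= ((matchProj ι Z' r).naturality k g).symm }
  have sq' : CommSq α' (copowerMap (ι ⋙ coyoneda.obj (op r)) i) f β' := by
    constructor
    ext s
    dsimp [copowerMap, α', β']
    apply Sigma.hom_ext
    intro g
    simpa using hw s g
  have e₁ : ∀ s (g : r ⟶ ι.obj s), i ≫ Sigma.ι (fun _ : r ⟶ ι.obj s ↦ B) g ≫ sq'.lift.app s =
      α ≫ (matchProj ι Z r).app s g := by
    intro s g
    have := Sigma.ι (fun _ : r ⟶ ι.obj s ↦ A) g ≫= congr_app sq'.fac_left s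
    dsimp [copowerMap, α'] at this
    simpa using! this
  have e₂ : ∀ s (g : r ⟶ ι.obj s), Sigma.ι (fun _ : r ⟶ ι.obj s ↦ B) g ≫ sq'.lift.app s ≫
      f.app s = β ≫ (matchProj ι Z' r).app s g := by
    intro s g
    have := Sigma.ι (fun _ : r ⟶ ι.obj s ↦ B) g ≫= congr_app sq'.fac_right s
    dsimp [β'] at this
    simpa using this
  let φ : MatchFamily ι Z r B :=
    { app s g := Sigma.ι (fun _ : r ⟶ ι.obj s ↦ B) g ≫ sq'.lift.app s
      naturality {s t} k g := by
        have := Sigma.ι (fun _ : r ⟶ ι.obj s ↦ B) g ≫= sq'.lift.naturality k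
        dsimp at this
        simp at this
        exact (Category.assoc _ _ _).trans this.symm }
  have hU := matchProj_isUniversal ι Z r
  refine ⟨⟨⟨hU.lift φ, hU.hom_ext fun s g ↦ ?_,
    (matchProj_isUniversal ι Z' r).hom_ext fun s g ↦ ?_⟩⟩⟩
  · rw [Category.assoc, hU.fac]
    exact e₁ s g
  · rw [Category.assoc, matchMap_matchProj, reassoc_of% hU.fac]
    exact (Category.assoc _ _ _).trans (e₂ s g)

end

section

variable [HasLimitsOfSize.{w, w} M]

/-- For a contravariant functor `H` to types, the map of diagrams `E ^ H ⟶ F ^ H`, which consists of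
the products `∏_{H s} E ⟶ ∏_{H s} F`. -/
noncomputable def powerMap (H : Pᵒᵖ ⥤ Type w) {E F : M} (p : E ⟶ F) :
    H.rightOp ⋙ piConst.{w}.obj E ⟶ H.rightOp ⋙ piConst.{w}.obj F :=
  Functor.whiskerLeft H.rightOp (piConst.{w}.map p)

/-- The relative matching map of `E ^ H ⟶ F ^ H` at `s` is a product of copies of `E ⟶ F` and of
identities if the latching map of `H` at `s` is injective. The hypothesis expresses this injectivity
by zigzags. -/
lemma matchLift_powerMap (ι : P₁ ⥤ P) (H : Pᵒᵖ ⥤ Type w) (s : P)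
    (hH : ∀ (t : P₁) (g : s ⟶ ι.obj t) (h : H.obj (op (ι.obj t))),
      ∃ (t₀ : P₁) (g₀ : s ⟶ ι.obj t₀) (h₀ : H.obj (op (ι.obj t₀))),
        ∀ (t' : P₁) (g' : s ⟶ ι.obj t') (h' : H.obj (op (ι.obj t'))),
          H.map g'.op h' = H.map g.op h →
          ∃ (t₁ : P₁) (h₁ : H.obj (op (ι.obj t₁))) (a : t' ⟶ t₁) (b : t₀ ⟶ t₁),
            H.map (ι.map a).op h₁ = h' ∧ H.map (ι.map b).op h₁ = h₀ ∧
              g' ≫ ι.map a = g₀ ≫ ι.map b)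
    {A B E F : M} (i : A ⟶ B) (p : E ⟶ F) [HasLiftingProperty i p] :
    MatchLift ι (powerMap H p) s i := by
  intro φ α β h₁ h₂ h₃
  let ψ : ∀ (t : P₁) (_ : s ⟶ ι.obj t) (_ : H.obj (op (ι.obj t))), B ⟶ E := fun t g h ↦
    φ.app t g ≫ Pi.π (fun _ : H.obj (op (ι.obj t)) ↦ E) h
  have hψ : ∀ {t t' : P₁} (a : t' ⟶ t) (g : s ⟶ ι.obj t') (h : H.obj (op (ι.obj t))),
      ψ t' g (H.map (ι.map a).op h) = ψ t (g ≫ ι.map a) h := by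
    intro t t' a g h
    simp only [ψ]
    rw [← φ.naturality a g]
    dsimp
    simp
  -- by connectedness, `ψ` only depends on the image in `H s`
  have hψ' : ∀ (t t' : P₁) (g : s ⟶ ι.obj t) (g' : s ⟶ ι.obj t') (h : H.obj (op (ι.obj t)))
      (h' : H.obj (op (ι.obj t'))), H.map g.op h = H.map g'.op h' → ψ t g h = ψ t' g' h' := by
    intro t t' g g' h h' w
    obtain ⟨t₀, g₀, h₀, K⟩ := hH t g h
    have key : ∀ (u : P₁) (k : s ⟶ ι.obj u) (l : H.obj (op (ι.obj u))),
        H.map k.op l = H.map g.op h → ψ u k l = ψ t₀ g₀ h₀ := by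
      intro u k l hkl
      obtain ⟨t₁, h₁, a, b, rfl, rfl, hab⟩ := K u k l hkl
      rw [hψ, hψ, hab]
    rw [key t g h rfl, key t' g' h' w.symm]
  have key : ∀ x : H.obj (op s), ∃ l : B ⟶ E,
      (∀ (t : P₁) (g : s ⟶ ι.obj t) (h : H.obj (op (ι.obj t))),
        H.map g.op h = x → ψ t g h = l) ∧
      i ≫ l = β ≫ Pi.π (fun _ : H.obj (op s) ↦ E) x ∧
      l ≫ p = α ≫ Pi.π (fun _ : H.obj (op s) ↦ F) x := by
    intro x
    by_cases hx : ∃ (t : P₁) (g : s ⟶ ι.obj t) (h : H.obj (op (ι.obj t))), H.map g.op h = x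
    · obtain ⟨t, g, h, rfl⟩ := hx
      refine ⟨ψ t g h, fun t' g' h' w ↦ hψ' _ _ _ _ _ _ w, ?_, ?_⟩
      · have := h₃ t g =≫ Pi.π (fun _ : H.obj (op (ι.obj t)) ↦ E) h
        dsimp at this
        simpa [ψ] using! this
      · have := h₁ t g =≫ Pi.π (fun _ : H.obj (op (ι.obj t)) ↦ F) h
        dsimp [powerMap] at this
        simpa [ψ] using! this
    · have sq : CommSq (β ≫ Pi.π (fun _ : H.obj (op s) ↦ E) x) i p
          (α ≫ Pi.π (fun _ : H.obj (op s) ↦ F) x) := by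
        constructor
        have := h₂ =≫ Pi.π (fun _ : H.obj (op s) ↦ F) x
        dsimp [powerMap] at this
        simpa using! this
      exact ⟨sq.lift, fun t g h w ↦ (hx ⟨t, g, h, w⟩).elim, sq.fac_left, sq.fac_right⟩
  choose l hl₁ hl₂ hl₃ using key
  refine ⟨Limits.Pi.lift l, fun t g ↦ ?_, ?_, ?_⟩
  · dsimp
    apply Pi.hom_ext
    intro h
    simp
    exact (hl₁ _ t g h rfl).symm
  · dsimp [powerMap]
    apply Pi.hom_ext
    intro h
    simp
    exact hl₃ h
  · apply Pi.hom_ext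
    intro h
    refine (Category.assoc _ _ _).trans ?_
    refine (congrArg (i ≫ ·) (Pi.lift_π l h)).trans (hl₂ h)

end

section

variable [HasColimitsOfSize.{w, w} M]

/-- If the powers with respect to the representable functor at `r` send `R` to `RP`, then the
latching object functor at `r` sends `LP` to `L`. -/
lemma latchMap_mem_of_wfs [HasLimitsOfSize.{w, w} M] (ι : P ⥤ Q) (r : Q)
    {LP RP : MorphismProperty (P ⥤ M)} {L R : MorphismProperty M}
    [MorphismProperty.IsWeakFactorizationSystem LP RP]
    [MorphismProperty.IsWeakFactorizationSystem L R]
    (hR : ∀ {E F : M} (p : E ⟶ F), R p → RP (powerMap (ι.op ⋙ yoneda.obj r) p))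
    {Z Z' : P ⥤ M} (f : Z ⟶ Z') (hf : LP f) : L (latchMap (ι := ι) f r) := by
  rw [← MorphismProperty.llp_eq_of_wfs L R]
  intro E F p hp
  have := MorphismProperty.hasLiftingProperty_of_wfs _ _ hf (hR p hp)
  refine ⟨fun {α β} sq ↦ ?_⟩
  have hw : ∀ s g, ((latchInj ι Z r).app s g ≫ α) ≫ p =
      f.app s ≫ (latchInj ι Z' r).app s g ≫ β := by
    intro s g
    rw [← reassoc_of% latchInj_latchMap, Category.assoc, sq.w]
  let α' : Z ⟶ (ι.op ⋙ yoneda.obj r).rightOp ⋙ piConst.obj E :=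
    { app s := Limits.Pi.lift fun g : ι.obj s ⟶ r ↦ (latchInj ι Z r).app s g ≫ α
      naturality s t k := by
        dsimp
        apply Pi.hom_ext
        intro g
        simpa using ((latchInj ι Z r).naturality k g) =≫ α }
  let β' : Z' ⟶ (ι.op ⋙ yoneda.obj r).rightOp ⋙ piConst.obj F :=
    { app s := Limits.Pi.lift fun g : ι.obj s ⟶ r ↦ (latchInj ι Z' r).app s g ≫ β
      naturality s t k := by
        dsimp
        apply Pi.hom_ext
        intro g
        simpa using ((latchInj ι Z' r).naturality k g) =≫ β }
  have sq' : CommSq α' f (powerMap (ι.op ⋙ yoneda.obj r) p) β' := by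
    constructor
    ext s
    dsimp [powerMap, α', β']
    apply Pi.hom_ext
    intro g
    simpa using hw s g
  have e₁ : ∀ s (g : ι.obj s ⟶ r), (sq'.lift.app s ≫ Pi.π (fun _ : ι.obj s ⟶ r ↦ E) g) ≫ p =
      (latchInj ι Z' r).app s g ≫ β := by
    intro s g
    have := congr_app sq'.fac_right s =≫ Pi.π (fun _ : ι.obj s ⟶ r ↦ F) g
    dsimp [powerMap, β'] at this
    simpa using! this
  have e₂ : ∀ s (g : ι.obj s ⟶ r), f.app s ≫ sq'.lift.app s ≫
      Pi.π (fun _ : ι.obj s ⟶ r ↦ E) g = (latchInj ι Z r).app s g ≫ α := by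
    intro s g
    have := congr_app sq'.fac_left s =≫ Pi.π (fun _ : ι.obj s ⟶ r ↦ E) g
    dsimp [α'] at this
    simpa using! this
  let φ : LatchFamily ι Z' r E :=
    { app s g := sq'.lift.app s ≫ Pi.π (fun _ : ι.obj s ⟶ r ↦ E) g
      naturality {s t} k g := by
        simp }
  have hU := latchInj_isUniversal ι Z' r
  refine ⟨⟨⟨hU.desc φ, (latchInj_isUniversal ι Z r).hom_ext fun s g ↦ ?_,
    hU.hom_ext fun s g ↦ ?_⟩⟩⟩
  · rw [reassoc_of% latchInj_latchMap, hU.fac]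
    exact e₂ s g
  · rw [reassoc_of% hU.fac]
    exact e₁ s g

end

end Free

/-! ### The Reedy model structure at the next stage -/

section Stage

variable {R : Type w} [SmallCategory R] {Rm Rp : MorphismProperty R}
  [Rm.IsMultiplicative] [Rp.IsMultiplicative] (S : ReedyStructure Rm Rp Ordinal.{t})
  {M : Type u} [Category.{v} M] (μ : Ordinal.{t})

/-- The inclusion of the objects of degree less than `μ`. -/
abbrev stageInl : Below S μ ⥤ Stage S μ := Glue.inl _ _

section Model

variable [ModelCategory M]

lemma copowerMap_mem_reedyCofibrations [HasColimitsOfSize.{w, w} M] (r : Stage S μ)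
    {A B : M} (i : A ⟶ B) (hi : cofibrations M i) :
    reedyCofibrations (below S μ) M (copowerMap (stageInl S μ ⋙ coyoneda.obj (op r)) i) := by
  intro s
  rw [← MorphismProperty.llp_eq_of_wfs (cofibrations M) (trivialFibrations M)]
  intro E F p hp
  have := MorphismProperty.hasLiftingProperty_of_wfs i p hi hp
  rw [hasLiftingProperty_relLatchingMap_iff]
  refine latchLift_copowerMap _ _ _ (fun t g h ↦ ?_) i p
  obtain ⟨z, g₀, h₀, H⟩ := exists_zigzag S (InducedCategory.Hom.hom h ≫ g.hom)
  have hz := (H _ (InducedCategory.Hom.hom h) g.hom rfl).1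
  refine ⟨⟨⟨z, hz.trans_lt t.obj.property⟩, hz.trans_lt t.property⟩, ObjectProperty.homMk h₀,
    Glue.homMk g₀, fun t' g' h' w ↦ ?_⟩
  obtain ⟨-, t₁, g₁, a, b, ht₁, e₁, e₂, e₃⟩ :=
    H _ (InducedCategory.Hom.hom h') g'.hom (congrArg InducedCategory.Hom.hom w)
  exact ⟨⟨⟨t₁, ht₁.trans_lt t'.obj.property⟩, ht₁.trans_lt t'.property⟩, Glue.homMk g₁,
    ObjectProperty.homMk (ObjectProperty.homMk a), ObjectProperty.homMk (ObjectProperty.homMk b),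
    InducedCategory.hom_ext e₁, InducedCategory.hom_ext e₂, ObjectProperty.hom_ext _ e₃⟩

lemma powerMap_mem_reedyFibrations [HasLimitsOfSize.{w, w} M] (r : Stage S μ)
    {E F : M} (p : E ⟶ F) (hp : fibrations M p) :
    reedyFibrations (below S μ) M (powerMap ((stageInl S μ).op ⋙ yoneda.obj r) p) := by
  intro s
  rw [← MorphismProperty.rlp_eq_of_wfs (trivialCofibrations M) (fibrations M)]
  intro A B i hi
  have := MorphismProperty.hasLiftingProperty_of_wfs i p hi hp
  rw [hasLiftingProperty_relMatchingMap_iff]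
  refine matchLift_powerMap _ _ _ (fun t g (h : (stageInl S μ).obj t.obj ⟶ r) ↦ ?_) i p
  obtain ⟨z, g₀, h₀, H⟩ := exists_zigzag' S (g.hom ≫ (Glue.toBase _ _).map h)
  have hz := (H _ g.hom ((Glue.toBase _ _).map h) rfl).1
  refine ⟨⟨⟨z, hz.trans_lt t.obj.property⟩, hz.trans_lt t.property⟩, ObjectProperty.homMk g₀,
    Glue.homMk h₀, fun t' g' (h' : (stageInl S μ).obj t'.obj ⟶ r) w ↦ ?_⟩
  obtain ⟨-, t₁, h₁, a, b, ht₁, e₁, e₂, e₃⟩ :=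
    H _ g'.hom ((Glue.toBase _ _).map h')
      (congrArg (fun k : (stageInl S μ).obj s ⟶ r ↦ (Glue.toBase _ _).map k) w)
  exact ⟨⟨⟨t₁, ht₁.trans_lt t'.obj.property⟩, ht₁.trans_lt t'.property⟩, Glue.homMk h₁,
    ObjectProperty.homMk (ObjectProperty.homMk a), ObjectProperty.homMk (ObjectProperty.homMk b),
    InducedCategory.hom_ext e₁, InducedCategory.hom_ext e₂, ObjectProperty.hom_ext _ e₃⟩

variable [HasLimitsOfSize.{w, w} M] [HasColimitsOfSize.{w, w} M]

variable (M) in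
/-- The cofibrations of the glued model structure. -/
abbrev stageCofibrations : MorphismProperty (Stage S μ ⥤ M) :=
  Glue.gluedLeft _ _ (reedyCofibrations (below S μ) M) (cofibrations M)

variable (M) in
/-- The fibrations of the glued model structure. -/
abbrev stageFibrations : MorphismProperty (Stage S μ ⥤ M) :=
  Glue.gluedRight _ _ (reedyFibrations (below S μ) M) (fibrations M)

instance hasTwoOutOfThreeProperty_reedyWeakEquivalences (J : Type w) [SmallCategory J] :
    (reedyWeakEquivalences M J).HasTwoOutOfThreeProperty where
  comp_mem _ _ hf hg r := (weakEquivalences M).comp_mem _ _ (hf r) (hg r)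
  of_postcomp f g hg hfg r := (weakEquivalences M).of_postcomp (f.app r) (g.app r) (hg r) (hfg r)
  of_precomp f g hf hfg r := (weakEquivalences M).of_precomp (f.app r) (g.app r) (hf r) (hfg r)

variable (hμ : ReedyTripleIsModel (below S μ) M)

include hμ in
lemma isWeakFactorizationSystem_of_isModel :
    MorphismProperty.IsWeakFactorizationSystem (reedyCofibrations (below S μ) M)
      (reedyFibrations (below S μ) M ⊓ reedyWeakEquivalences M _) ∧
    MorphismProperty.IsWeakFactorizationSystem
      (reedyCofibrations (below S μ) M ⊓ reedyWeakEquivalences M _)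
      (reedyFibrations (below S μ) M) := by
  obtain ⟨m, hC, hW, hF⟩ := hμ
  rw [← hC, ← hW, ← hF]
  exact ⟨inferInstanceAs (MorphismProperty.IsWeakFactorizationSystem
      (cofibrations (Below S μ ⥤ M)) (trivialFibrations (Below S μ ⥤ M))),
    inferInstanceAs (MorphismProperty.IsWeakFactorizationSystem
      (trivialCofibrations (Below S μ ⥤ M)) (fibrations (Below S μ ⥤ M)))⟩

include hμ in
/-- A fibration of the glued structure is a weak equivalence if and only if it is one below `μ` and
its relative matching maps are weak equivalences: the maps which it induces on the matching objects
at the objects of degree `μ` are trivial fibrations. -/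
lemma stageFibrations_inf_weakEquivalences :
    stageFibrations S M μ ⊓ reedyWeakEquivalences M (Stage S μ) =
      Glue.gluedRight _ _ (reedyFibrations (below S μ) M ⊓ reedyWeakEquivalences M _)
        (trivialFibrations M) := by
  have := (isWeakFactorizationSystem_of_isModel S μ hμ).1
  have key : ∀ {X Y : Stage S μ ⥤ M} (f : X ⟶ Y) (x : DegEq S μ),
      (reedyFibrations (below S μ) M ⊓ reedyWeakEquivalences M _)
        (Functor.whiskerLeft (stageInl S μ) f) →
      (weakEquivalences M (f.app (.top x)) ↔
        weakEquivalences M (relMatch (stageInl S μ) f (.top x))) := by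
    intro X Y f x hf
    have h₁ := MorphismProperty.pullback_snd _ (toMatch (stageInl S μ) Y (.top x))
      (matchMap_mem_of_wfs (stageInl S μ) (.top x) (R := trivialFibrations M)
        (copowerMap_mem_reedyCofibrations S μ (.top x)) _ hf)
    have h₂ : relMatch (stageInl S μ) f (.top x) ≫ pullback.snd _ _ = f.app (.top x) :=
      pullback.lift_snd _ _ _
    rw [← h₂]
    exact MorphismProperty.postcomp_iff _ (W' := weakEquivalences M) _ _ h₁.2
  ext X Y f
  constructor
  · rintro ⟨⟨h₁, h₂⟩, h₃⟩
    have h₄ : (reedyFibrations (below S μ) M ⊓ reedyWeakEquivalences M _)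
        (Functor.whiskerLeft (stageInl S μ) f) := ⟨h₁, fun r ↦ h₃ (.low r)⟩
    exact ⟨h₄, fun x ↦ ⟨h₂ x, (key f x h₄).1 (h₃ _)⟩⟩
  · rintro ⟨h₁, h₂⟩
    refine ⟨⟨h₁.1, fun x ↦ (h₂ x).1⟩, ?_⟩
    rintro (r | x)
    · exact h₁.2 r
    · exact (key f x h₁).2 (h₂ x).2

include hμ in
/-- A cofibration of the glued structure is a weak equivalence if and only if it is one below `μ`
and its relative latching maps are weak equivalences: the maps which it induces on the latching
objects at the objects of degree `μ` are trivial cofibrations. -/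
lemma stageCofibrations_inf_weakEquivalences :
    stageCofibrations S M μ ⊓ reedyWeakEquivalences M (Stage S μ) =
      Glue.gluedLeft _ _ (reedyCofibrations (below S μ) M ⊓ reedyWeakEquivalences M _)
        (trivialCofibrations M) := by
  have := (isWeakFactorizationSystem_of_isModel S μ hμ).2
  have key : ∀ {X Y : Stage S μ ⥤ M} (f : X ⟶ Y) (x : DegEq S μ),
      (reedyCofibrations (below S μ) M ⊓ reedyWeakEquivalences M _)
        (Functor.whiskerLeft (stageInl S μ) f) →
      (weakEquivalences M (f.app (.top x)) ↔
        weakEquivalences M (relLatch (stageInl S μ) f (.top x))) := by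
    intro X Y f x hf
    have h₁ := MorphismProperty.pushout_inr _ (latchTo (stageInl S μ) X (.top x))
      (latchMap_mem_of_wfs (stageInl S μ) (.top x) (L := trivialCofibrations M)
        (powerMap_mem_reedyFibrations S μ (.top x)) _ hf)
    have h₂ : pushout.inr _ _ ≫ relLatch (stageInl S μ) f (.top x) = f.app (.top x) :=
      pushout.inr_desc _ _ _
    rw [← h₂]
    exact MorphismProperty.precomp_iff _ (W' := weakEquivalences M) _ _ h₁.2
  ext X Y f
  constructor
  · rintro ⟨⟨h₁, h₂⟩, h₃⟩
    have h₄ : (reedyCofibrations (below S μ) M ⊓ reedyWeakEquivalences M _)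
        (Functor.whiskerLeft (stageInl S μ) f) := ⟨h₁, fun r ↦ h₃ (.low r)⟩
    exact ⟨h₄, fun x ↦ ⟨h₂ x, (key f x h₄).1 (h₃ _)⟩⟩
  · rintro ⟨h₁, h₂⟩
    refine ⟨⟨h₁.1, fun x ↦ (h₂ x).1⟩, ?_⟩
    rintro (r | x)
    · exact h₁.2 r
    · exact (key f x h₁).2 (h₂ x).2

include hμ in
/-- The glued model structure on the diagrams of shape `Stage S μ`. -/
theorem makesModelCategory_stage :
    MakesModelCategory (stageCofibrations S M μ) (reedyWeakEquivalences M (Stage S μ))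
      (stageFibrations S M μ) := by
  obtain ⟨hCF, hCF'⟩ := isWeakFactorizationSystem_of_isModel S μ hμ
  let : CategoryWithCofibrations (Stage S μ ⥤ M) := ⟨stageCofibrations S M μ⟩
  let : CategoryWithFibrations (Stage S μ ⥤ M) := ⟨stageFibrations S M μ⟩
  let : CategoryWithWeakEquivalences (Stage S μ ⥤ M) := ⟨reedyWeakEquivalences M (Stage S μ)⟩
  have : (weakEquivalences (Stage S μ ⥤ M)).HasTwoOutOfThreeProperty :=
    inferInstanceAs (reedyWeakEquivalences M (Stage S μ)).HasTwoOutOfThreeProperty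
  have : MorphismProperty.IsWeakFactorizationSystem (cofibrations (Stage S μ ⥤ M))
      (trivialFibrations (Stage S μ ⥤ M)) := by
    change MorphismProperty.IsWeakFactorizationSystem (stageCofibrations S M μ)
      (stageFibrations S M μ ⊓ reedyWeakEquivalences M (Stage S μ))
    rw [stageFibrations_inf_weakEquivalences S μ hμ]
    exact Glue.isWeakFactorizationSystem_glued _ _ (isReedyLike_stage S μ) _ _ _ _
  have : MorphismProperty.IsWeakFactorizationSystem (trivialCofibrations (Stage S μ ⥤ M))
      (fibrations (Stage S μ ⥤ M)) := by
    change MorphismProperty.IsWeakFactorizationSystem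
      (stageCofibrations S M μ ⊓ reedyWeakEquivalences M (Stage S μ)) (stageFibrations S M μ)
    rw [stageCofibrations_inf_weakEquivalences S μ hμ]
    exact Glue.isWeakFactorizationSystem_glued _ _ (isReedyLike_stage S μ) _ _ _ _
  exact ⟨ModelCategory.mk' _, rfl, rfl, rfl⟩

end Model

end Stage

/-! ### Comparison with the full subcategory on the objects of degree less than `μ + 1` -/

section Comparison

variable {R : Type w} [SmallCategory R] {Rm Rp : MorphismProperty R}
  [Rm.IsMultiplicative] [Rp.IsMultiplicative] (S : ReedyStructure Rm Rp Ordinal.{t})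
  {M : Type u} [Category.{v} M] (μ : Ordinal.{t})

/-- The equivalence from `Stage S μ` to the full subcategory of the objects of degree less than
`μ + 1`. -/
def stageToBelow : Stage S μ ⥤ Below S (μ + 1) :=
  ObjectProperty.lift _ (Glue.toBase _ _) (by
    rintro (p | x)
    · exact p.property.trans (Order.lt_add_one_iff.2 le_rfl)
    · exact Order.lt_add_one_iff.2 x.2.le)

instance : (stageToBelow S μ).Full := by unfold stageToBelow; infer_instance
instance : (stageToBelow S μ).Faithful := by unfold stageToBelow; infer_instance

lemma stageToBelow_obj_surjective (r : Below S (μ + 1)) : ∃ a, (stageToBelow S μ).obj a = r := by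
  obtain ⟨r, hr⟩ := r
  rcases (Order.lt_add_one_iff.1 hr).lt_or_eq with h | h
  · exact ⟨.low ⟨r, h⟩, rfl⟩
  · exact ⟨.top ⟨r, h⟩, rfl⟩

instance : (stageToBelow S μ).IsEquivalence where
  essSurj := ⟨fun r ↦ by
    obtain ⟨a, rfl⟩ := stageToBelow_obj_surjective S μ r
    exact ⟨a, ⟨Iso.refl _⟩⟩⟩

instance : (stageInl S μ).Full := ⟨fun g ↦ ⟨ObjectProperty.homMk g.hom, rfl⟩⟩

/-- The objects of degree less than `κ`, seen inside of the objects of degree less than `μ` and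
inside of those of degree less than `μ + 1`. -/
def belowBelow (κ : Ordinal.{t}) : Below (below S μ) κ ⥤ Below (below S (μ + 1)) κ :=
  ObjectProperty.lift _ (incl (below S μ) κ ⋙ stageInl S μ ⋙ stageToBelow S μ)
    fun r ↦ r.property

instance (κ : Ordinal.{t}) : (belowBelow S μ κ).Full :=
  .of_comp_faithful_iso (ObjectProperty.liftCompιIso _ _ _)

lemma essSurj_belowBelow {κ : Ordinal.{t}} (h : κ ≤ μ) : (belowBelow S μ κ).EssSurj where
  mem_essImage := fun ⟨⟨r, _⟩, hr⟩ ↦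
    ⟨⟨⟨r, lt_of_lt_of_le (show S.deg r < κ from hr) h⟩, hr⟩, ⟨Iso.refl _⟩⟩

/-- The objects of degree less than `μ`, seen inside of the objects of degree less than `μ + 1`. -/
def belowToBelow {κ : Ordinal.{t}} (h : κ = μ) : Below S μ ⥤ Below (below S (μ + 1)) κ :=
  ObjectProperty.lift _ (stageInl S μ ⋙ stageToBelow S μ) fun r ↦ r.property.trans_eq h.symm

instance {κ : Ordinal.{t}} (h : κ = μ) : (belowToBelow S μ h).Full :=
  .of_comp_faithful_iso (ObjectProperty.liftCompιIso _ _ _)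

instance {κ : Ordinal.{t}} (h : κ = μ) : (belowToBelow S μ h).EssSurj where
  mem_essImage := fun ⟨⟨r, _⟩, hr⟩ ↦
    ⟨⟨r, (show S.deg r < κ from hr).trans_eq h⟩, ⟨Iso.refl _⟩⟩

lemma latchLift_low_iff {X Y : Below S (μ + 1) ⥤ M} (f : X ⟶ Y) (r : Below S μ)
    {E F : M} (p : E ⟶ F) :
    LatchLift (incl (below S μ) ((below S μ).deg r))
      (Functor.whiskerLeft (stageInl S μ) (Functor.whiskerLeft (stageToBelow S μ) f)) r p ↔
    LatchLift (incl (below S (μ + 1)) ((below S (μ + 1)).deg ((stageToBelow S μ).obj (.low r))))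
      f ((stageToBelow S μ).obj (.low r)) p :=
  have := essSurj_belowBelow S μ (κ := (below S μ).deg r) r.property.le
  latchLift_whiskerLeft_iff (F := stageInl S μ ⋙ stageToBelow S μ)
    (e := belowBelow S μ ((below S μ).deg r)) (Iso.refl _) f r p

lemma latchLift_top_iff {X Y : Below S (μ + 1) ⥤ M} (f : X ⟶ Y) (x : DegEq S μ)
    {E F : M} (p : E ⟶ F) :
    LatchLift (stageInl S μ) (Functor.whiskerLeft (stageToBelow S μ) f) (.top x) p ↔
    LatchLift (incl (below S (μ + 1)) ((below S (μ + 1)).deg ((stageToBelow S μ).obj (.top x))))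
      f ((stageToBelow S μ).obj (.top x)) p :=
  latchLift_whiskerLeft_iff (F := stageToBelow S μ)
    (e := belowToBelow S μ x.2) (Iso.refl _) f (.top x) p

lemma matchLift_low_iff {X Y : Below S (μ + 1) ⥤ M} (f : X ⟶ Y) (r : Below S μ)
    {A B : M} (i : A ⟶ B) :
    MatchLift (incl (below S μ) ((below S μ).deg r))
      (Functor.whiskerLeft (stageInl S μ) (Functor.whiskerLeft (stageToBelow S μ) f)) r i ↔
    MatchLift (incl (below S (μ + 1)) ((below S (μ + 1)).deg ((stageToBelow S μ).obj (.low r))))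
      f ((stageToBelow S μ).obj (.low r)) i :=
  have := essSurj_belowBelow S μ (κ := (below S μ).deg r) r.property.le
  matchLift_whiskerLeft_iff (F := stageInl S μ ⋙ stageToBelow S μ)
    (e := belowBelow S μ ((below S μ).deg r)) (Iso.refl _) f r i

lemma matchLift_top_iff {X Y : Below S (μ + 1) ⥤ M} (f : X ⟶ Y) (x : DegEq S μ)
    {A B : M} (i : A ⟶ B) :
    MatchLift (stageInl S μ) (Functor.whiskerLeft (stageToBelow S μ) f) (.top x) i ↔
    MatchLift (incl (below S (μ + 1)) ((below S (μ + 1)).deg ((stageToBelow S μ).obj (.top x))))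
      f ((stageToBelow S μ).obj (.top x)) i :=
  matchLift_whiskerLeft_iff (F := stageToBelow S μ)
    (e := belowToBelow S μ x.2) (Iso.refl _) f (.top x) i

variable [ModelCategory M]

lemma cofibrations_iff_of_lifting {A B A' B' : M} {i : A ⟶ B} {i' : A' ⟶ B'}
    (h : ∀ ⦃E F : M⦄ (p : E ⟶ F), HasLiftingProperty i p ↔ HasLiftingProperty i' p) :
    cofibrations M i ↔ cofibrations M i' := by
  rw [← MorphismProperty.llp_eq_of_wfs (cofibrations M) (trivialFibrations M)]
  exact forall₃_congr fun _ _ p ↦ imp_congr_right fun _ ↦ h p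

lemma fibrations_iff_of_lifting {E F E' F' : M} {p : E ⟶ F} {p' : E' ⟶ F'}
    (h : ∀ ⦃A B : M⦄ (i : A ⟶ B), HasLiftingProperty i p ↔ HasLiftingProperty i p') :
    fibrations M p ↔ fibrations M p' := by
  rw [← MorphismProperty.rlp_eq_of_wfs (trivialCofibrations M) (fibrations M)]
  exact forall₃_congr fun _ _ i ↦ imp_congr_right fun _ ↦ h i

lemma reedyCofibrations_below_add_one [HasColimitsOfSize.{w, w} M] :
    reedyCofibrations (below S (μ + 1)) M = (stageCofibrations S M μ).inverseImage
      ((Functor.whiskeringLeft _ _ M).obj (stageToBelow S μ)) := by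
  ext X Y f
  have hlow (r : Below S μ) :
      cofibrations M (relLatchingMap (below S (μ + 1)) f ((stageToBelow S μ).obj (.low r))) ↔
        cofibrations M (relLatchingMap (below S μ)
          (Functor.whiskerLeft (stageInl S μ) (Functor.whiskerLeft (stageToBelow S μ) f)) r) :=
    cofibrations_iff_of_lifting fun _ _ p ↦ by
      rw [hasLiftingProperty_relLatchingMap_iff, hasLiftingProperty_relLatchingMap_iff,
        latchLift_low_iff]
  have htop (x : DegEq S μ) :
      cofibrations M (relLatchingMap (below S (μ + 1)) f ((stageToBelow S μ).obj (.top x))) ↔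
        cofibrations M (relLatch (stageInl S μ)
          (Functor.whiskerLeft (stageToBelow S μ) f) (.top x)) :=
    cofibrations_iff_of_lifting fun _ _ p ↦ by
      rw [hasLiftingProperty_relLatchingMap_iff, hasLiftingProperty_relLatch_iff,
        latchLift_top_iff]
  refine ⟨fun h ↦ ⟨fun r ↦ (hlow r).1 (h _), fun x ↦ (htop x).1 (h _)⟩, fun h r ↦ ?_⟩
  obtain ⟨r | x, rfl⟩ := stageToBelow_obj_surjective S μ r
  · exact (hlow r).2 (h.1 r)
  · exact (htop x).2 (h.2 x)

lemma reedyFibrations_below_add_one [HasLimitsOfSize.{w, w} M] :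
    reedyFibrations (below S (μ + 1)) M = (stageFibrations S M μ).inverseImage
      ((Functor.whiskeringLeft _ _ M).obj (stageToBelow S μ)) := by
  ext X Y f
  have hlow (r : Below S μ) :
      fibrations M (relMatchingMap (below S (μ + 1)) f ((stageToBelow S μ).obj (.low r))) ↔
        fibrations M (relMatchingMap (below S μ)
          (Functor.whiskerLeft (stageInl S μ) (Functor.whiskerLeft (stageToBelow S μ) f)) r) :=
    fibrations_iff_of_lifting fun _ _ i ↦ by
      rw [hasLiftingProperty_relMatchingMap_iff, hasLiftingProperty_relMatchingMap_iff,
        matchLift_low_iff]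
  have htop (x : DegEq S μ) :
      fibrations M (relMatchingMap (below S (μ + 1)) f ((stageToBelow S μ).obj (.top x))) ↔
        fibrations M (relMatch (stageInl S μ)
          (Functor.whiskerLeft (stageToBelow S μ) f) (.top x)) :=
    fibrations_iff_of_lifting fun _ _ i ↦ by
      rw [hasLiftingProperty_relMatchingMap_iff, hasLiftingProperty_relMatch_iff,
        matchLift_top_iff]
  refine ⟨fun h ↦ ⟨fun r ↦ (hlow r).1 (h _), fun x ↦ (htop x).1 (h _)⟩, fun h r ↦ ?_⟩
  obtain ⟨r | x, rfl⟩ := stageToBelow_obj_surjective S μ r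
  · exact (hlow r).2 (h.1 r)
  · exact (htop x).2 (h.2 x)

lemma reedyWeakEquivalences_below_add_one :
    reedyWeakEquivalences M (Below S (μ + 1)) =
      (reedyWeakEquivalences M (Stage S μ)).inverseImage
        ((Functor.whiskeringLeft _ _ M).obj (stageToBelow S μ)) := by
  ext X Y f
  refine ⟨fun h r ↦ h _, fun h r ↦ ?_⟩
  obtain ⟨r, rfl⟩ := stageToBelow_obj_surjective S μ r
  exact h r

end Comparison

end ReedyDiagrams

open ReedyDiagrams

theorem mainTheorem5 {R : Type w} [SmallCategory R] {Rm Rp : MorphismProperty R}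
    [Rm.IsMultiplicative] [Rp.IsMultiplicative] (S : ReedyStructure Rm Rp Ordinal.{t})
    {M : Type u} [Category.{v} M] [HasLimitsOfSize.{w, w} M] [HasColimitsOfSize.{w, w} M]
    [ModelCategory M] (μ : Ordinal.{t})
    (hμ : ReedyDiagrams.ReedyTripleIsModel (ReedyDiagrams.below S μ) M) :
    ReedyDiagrams.ReedyTripleIsModel (ReedyDiagrams.below S (μ + 1)) M := by
  obtain ⟨m, hC, hW, hF⟩ := makesModelCategory_stage S μ hμ
  let : CategoryWithCofibrations (Below S (μ + 1) ⥤ M) := ⟨reedyCofibrations (below S (μ + 1)) M⟩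
  let : CategoryWithFibrations (Below S (μ + 1) ⥤ M) := ⟨reedyFibrations (below S (μ + 1)) M⟩
  let : CategoryWithWeakEquivalences (Below S (μ + 1) ⥤ M) := ⟨reedyWeakEquivalences M _⟩
  refine ⟨ModelCategory.transport ((stageToBelow S μ).asEquivalence.congrLeft (E := M)).symm
    ?_ ?_ ?_, rfl, rfl, rfl⟩
  · exact (reedyCofibrations_below_add_one S μ).trans (by rw [← hC]; rfl)
  · exact (reedyFibrations_below_add_one S μ).trans (by rw [← hF]; rfl)
  · exact (reedyWeakEquivalences_below_add_one S μ).trans (by rw [← hW]; rfl)
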